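/- \textbf{Theorem.} Let $\sigma,\gamma,h>0$ and $H\in(\tfrac12,\tfrac34)$ be constants. For $i=1,2,\dots$ let $B^i$ be a Brownian motion and $B^{H,i}$ a fractional Brownian motion with Hurst index $H$ on $[0,\infty)$, independent of $B^i$, and put $M^i=\sigma B^i+\gamma B^{H,i}$; assume that the processes $M^i$ are mutually independent. Let $\phi_1,\phi_2,\dots$ be i.i.d. real random variables, independent of $(M^i)_{i\ge1}$, with $\mathbb E[\phi_i^4]<\infty$. Put $\theta_i=\phi_i-\sigma^2/2$ and let $Y^i_t=\log X^i_t=\theta_i t+M^i_t$, where $X^i_t=\exp(\theta_i t+M^i_t)$ is the solution of the mixed fractional Black--Scholes equation $dX^i_t=\phi_iX^i_t\,dt+X^i_t\,dM^i_t$, $X^i_0=1$. With $\Delta Y^i_k=Y^i_{(k+1)h}-Y^i_{kh}$, set $$\xi^i_n=\frac1n\sum_{k=0}^{n-1}(\Delta Y^i_k)^2,\quad \eta^i_n=\frac1n\sum_{k=0}^{n-1}\Delta Y^i_k\,\Delta Y^i_{k+1},\quad \zeta^i_n=\frac1n\sum_{k=0}^{n-1}\bigl(Y^i_{(k+2)h}-Y^i_{kh}\bigr)\bigl(Y^i_{(k+4)h}-Y^i_{(k+2)h}\bigr),\quad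 \hat\theta_i=\frac1{nh}\sum_{k=0}^{n-1}\Delta Y^i_k,$$ and let $\bar\xi_N,\bar\eta_N,\bar\zeta_N,\bar V_N$ be the averages over $i=1,\dots,N$ of $\xi^i_n,\eta^i_n,\zeta^i_n,\hat\theta_i^2$. With $\log_2^+x=\log_2x$ for $x>0$ and $\log_2^+x=0$ for $x\le0$, define the estimator $\widehat\Theta=(\widehat H,\widehat\gamma^2,\widehat\sigma^2)=g(\bar\xi_N,\bar\eta_N,\bar\zeta_N,\bar V_N)$ of $\Theta=(H,\gamma^2,\sigma^2)$ by $$\widehat H=\tfrac12\log_2^+\!\Bigl(\frac{\bar\zeta_N-4h^2\bar V_N}{\bar\eta_N-h^2\bar V_N}\Bigr),\qquad \widehat\gamma^2=\frac{\bar\eta_N-h^2\bar V_N}{h^{2\widehat H}(2^{2\widehat H-1}-1)},\qquad \widehat\sigma^2=\frac{\bar\xi_N-h^2\bar V_N-\widehat\gamma^2h^{2\widehat H}}{h}.$$ Let $n,N\to\infty$ in such a way that $n/N\to\infty$. Then: the means $\mathbb E(\bar\xi_N,\bar\eta_N,\bar\zeta_N,\bar V_N)$ converge to a vector $\mu_0\in\mathbb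 R^4$ at which $g$ is continuously differentiable; for every $i$ the matrices $$\begin{pmatrix}\mathrm{Cov}\bigl(\mathbb E[(\xi^i_n,\eta^i_n,\zeta^i_n)^\top\mid\theta_i]\bigr)&\mathcal C\\ \mathcal C^\top&\mathrm{Var}(\hat\theta_i^2)\end{pmatrix},\qquad \mathcal C=\begin{pmatrix}\mathrm{Cov}(\xi^i_n,\theta_i^2)\\ \mathrm{Cov}(\eta^i_n,\theta_i^2)\\ \mathrm{Cov}(\zeta^i_n,\theta_i^2)\end{pmatrix},$$ converge to a positive semidefinite matrix $\widetilde\Sigma$ that does not depend on $i$; and $$\sqrt N\,(\widehat\Theta-\Theta)\ \xrightarrow{d}\ \mathcal N\bigl(0,\ J(\mu_0)\,\widetilde\Sigma\,J(\mu_0)^\top\bigr),$$ where $J(\mu_0)$ is the $3\times4$ Jacobian matrix of $g$ at $\mu_0$. (The limit law may be degenerate.) -/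

import Mathlib

open MeasureTheory ProbabilityTheory Filter Topology
open scoped NNReal

noncomputable section

namespace MixedFBS

variable {Ω : Type*} [MeasurableSpace Ω]

/-- `X` is a fractional Brownian motion on `[0, ∞)` with Hurst index `H`: a centred Gaussian process
with covariance `(s ^ 2H + t ^ 2H - |s - t| ^ 2H) / 2` and almost surely continuous paths. -/
structure IsFractionalBrownian (H : ℝ) (X : ℝ≥0 → Ω → ℝ) (P : Measure Ω) : Prop where
  gaussian : IsGaussianProcess X P
  centred : ∀ t, ∫ ω, X t ω ∂P = 0
  covariance_eq : ∀ s t : ℝ≥0, cov[X s, X t; P] =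
    ((s : ℝ) ^ (2 * H) + (t : ℝ) ^ (2 * H) - |(s : ℝ) - (t : ℝ)| ^ (2 * H)) / 2
  continuous_paths : ∀ᵐ ω ∂P, Continuous fun t ↦ X t ω

/-- The mixed process `M = σ B + γ B^H`. -/
def mixed (σ γ : ℝ) (B BH : ℝ≥0 → Ω → ℝ) (t : ℝ≥0) (ω : Ω) : ℝ :=
  σ * B t ω + γ * BH t ω

/-- The solution `X_t = exp ((φ - σ² / 2) t + M_t)` of the mixed fractional Black-Scholes equation
`dX = φ X dt + X dM`, `X_0 = 1`, with random effect `φ`. -/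
def solution (σ : ℝ) (φ : Ω → ℝ) (M : ℝ≥0 → Ω → ℝ) (t : ℝ≥0) (ω : Ω) : ℝ :=
  Real.exp ((φ ω - σ ^ 2 / 2) * t + M t ω)

/-- The observed process `Y = log X`. -/
def logSolution (σ : ℝ) (φ : Ω → ℝ) (M : ℝ≥0 → Ω → ℝ) (t : ℝ≥0) (ω : Ω) : ℝ :=
  Real.log (solution σ φ M t ω)

/-- The drift `θ = φ - σ² / 2` of `Y`. -/
def drift (σ : ℝ) (φ : Ω → ℝ) (ω : Ω) : ℝ := φ ω - σ ^ 2 / 2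

/-- The probabilistic assumptions of the model: the `B i` are Brownian motions, the `BH i` are
fractional Brownian motions independent of `B i`, the mixed processes of the subjects are mutually
independent, and the random effects `φ i` are i.i.d. and independent of the mixed processes. -/
structure Model (P : Measure Ω) (H σ γ : ℝ) (B BH : ℕ → ℝ≥0 → Ω → ℝ) (φ : ℕ → Ω → ℝ) : Prop where
  measurable_B : ∀ i t, Measurable (B i t)
  measurable_BH : ∀ i t, Measurable (BH i t)
  measurable_φ : ∀ i, Measurable (φ i)
  brownian : ∀ i, IsBrownianReal (B i) P
  fractional : ∀ i, IsFractionalBrownian H (BH i) P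
  indep_B_BH : ∀ i, IndepFun (fun ω t ↦ B i t ω) (fun ω t ↦ BH i t ω) P
  indep_mixed : iIndepFun (fun i ω t ↦ mixed σ γ (B i) (BH i) t ω) P
  indep_φ : iIndepFun φ P
  identDistrib_φ : ∀ i j, IdentDistrib (φ i) (φ j) P P
  indep_φ_mixed : IndepFun (fun ω i ↦ φ i ω) (fun ω i t ↦ mixed σ γ (B i) (BH i) t ω) P

/-- `ΔY_k = Y_{(k+1)h} - Y_{kh}`. -/
def incr (Y : ℝ≥0 → Ω → ℝ) (h : ℝ≥0) (k : ℕ) (ω : Ω) : ℝ :=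
  Y (((k + 1 : ℕ) : ℝ≥0) * h) ω - Y ((k : ℝ≥0) * h) ω

/-- `ξ_n`. -/
def xiStat (Y : ℝ≥0 → Ω → ℝ) (h : ℝ≥0) (n : ℕ) (ω : Ω) : ℝ :=
  (1 / n) * ∑ k ∈ Finset.range n, incr Y h k ω ^ 2

/-- `η_n`. -/
def etaStat (Y : ℝ≥0 → Ω → ℝ) (h : ℝ≥0) (n : ℕ) (ω : Ω) : ℝ :=
  (1 / n) * ∑ k ∈ Finset.range n, incr Y h k ω * incr Y h (k + 1) ω

/-- `ζ_n`. -/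
def zetaStat (Y : ℝ≥0 → Ω → ℝ) (h : ℝ≥0) (n : ℕ) (ω : Ω) : ℝ :=
  (1 / n) * ∑ k ∈ Finset.range n,
    (Y (((k + 2 : ℕ) : ℝ≥0) * h) ω - Y ((k : ℝ≥0) * h) ω) *
      (Y (((k + 4 : ℕ) : ℝ≥0) * h) ω - Y (((k + 2 : ℕ) : ℝ≥0) * h) ω)

/-- The drift estimator `θ̂ = (nh)⁻¹ ∑_{k<n} ΔY_k` of one subject. -/
def driftEst (Y : ℝ≥0 → Ω → ℝ) (h : ℝ≥0) (n : ℕ) (ω : Ω) : ℝ :=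
  (1 / (n * h)) * ∑ k ∈ Finset.range n, incr Y h k ω

/-- The three moment statistics `(ξ_n, η_n, ζ_n)` of one subject. -/
def momentStat (Y : ℝ≥0 → Ω → ℝ) (h : ℝ≥0) (n : ℕ) : Fin 3 → Ω → ℝ :=
  ![xiStat Y h n, etaStat Y h n, zetaStat Y h n]

/-- The averages `(ξ̄, η̄, ζ̄, V̄)` over the first `N` subjects, where `V̄` averages `θ̂_i²`. -/
def avgStat (Y : ℕ → ℝ≥0 → Ω → ℝ) (h : ℝ≥0) (n N : ℕ) (ω : Ω) : Fin 4 → ℝ :=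
  ![(1 / N) * ∑ i ∈ Finset.range N, xiStat (Y i) h n ω,
    (1 / N) * ∑ i ∈ Finset.range N, etaStat (Y i) h n ω,
    (1 / N) * ∑ i ∈ Finset.range N, zetaStat (Y i) h n ω,
    (1 / N) * ∑ i ∈ Finset.range N, driftEst (Y i) h n ω ^ 2]

/-- `log₂⁺ x = log₂ x` for `x > 0` and `0` for `x ≤ 0`. -/
def logTwoPlus (x : ℝ) : ℝ := if 0 < x then Real.logb 2 x else 0

/-- `Ĥ` as a function of `x = (ξ̄, η̄, ζ̄, V̄)`. -/
def hurstMap (h : ℝ) (x : Fin 4 → ℝ) : ℝ :=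
  (1 / 2) * logTwoPlus ((x 2 - 4 * h ^ 2 * x 3) / (x 1 - h ^ 2 * x 3))

/-- `γ̂²` as a function of `x = (ξ̄, η̄, ζ̄, V̄)`. -/
def gammaSqMap (h : ℝ) (x : Fin 4 → ℝ) : ℝ :=
  (x 1 - h ^ 2 * x 3) /
    (h ^ (2 * hurstMap h x) * ((2 : ℝ) ^ (2 * hurstMap h x - 1) - 1))

/-- `σ̂²` as a function of `x = (ξ̄, η̄, ζ̄, V̄)`. -/
def sigmaSqMap (h : ℝ) (x : Fin 4 → ℝ) : ℝ :=
  (x 0 - h ^ 2 * x 3 - gammaSqMap h x * h ^ (2 * hurstMap h x)) / h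

/-- The map `(ξ̄, η̄, ζ̄, V̄) ↦ (Ĥ, γ̂², σ̂²)`. -/
def estMap (h : ℝ) (x : Fin 4 → ℝ) : Fin 3 → ℝ :=
  ![hurstMap h x, gammaSqMap h x, sigmaSqMap h x]

/-- The Jacobian matrix of `estMap h` at `x`: the entry `(a, b)` is the partial derivative of the
`a`-th estimator with respect to the `b`-th statistic. -/
def jacobian (h : ℝ) (x : Fin 4 → ℝ) : Matrix (Fin 3) (Fin 4) ℝ :=
  Matrix.of fun a b ↦ fderiv ℝ (estMap h) x (Pi.single b 1) a

/-- The estimator `Θ̂ = (Ĥ, γ̂², σ̂²)` from `n` increments of each of `N` subjects. -/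
def estimator (Y : ℕ → ℝ≥0 → Ω → ℝ) (h : ℝ≥0) (n N : ℕ) (ω : Ω) : Fin 3 → ℝ :=
  estMap h (avgStat Y h n N ω)

/-- `Σ`, the covariance matrix of `E[(ξ_n, η_n, ζ_n) | θ]`. -/
def condCov (P : Measure Ω) (Y : ℝ≥0 → Ω → ℝ) (θ : Ω → ℝ) (h : ℝ≥0) (n : ℕ) :
    Matrix (Fin 3) (Fin 3) ℝ :=
  Matrix.of fun a b ↦
    cov[P[momentStat Y h n a | MeasurableSpace.comap θ inferInstance],
      P[momentStat Y h n b | MeasurableSpace.comap θ inferInstance]; P]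

/-- `𝒞`, the column of covariances of `ξ_n, η_n, ζ_n` with `θ²`. -/
def crossCov (P : Measure Ω) (Y : ℝ≥0 → Ω → ℝ) (θ : Ω → ℝ) (h : ℝ≥0) (n : ℕ) :
    Matrix (Fin 3) (Fin 1) ℝ :=
  Matrix.of fun a _ ↦ cov[momentStat Y h n a, fun ω ↦ θ ω ^ 2; P]

/-- The block matrix `Σ̃ = (Σ, 𝒞; 𝒞ᵀ, Var θ̂²)` of one subject with `n` increments. -/
def jointCov (P : Measure Ω) (Y : ℝ≥0 → Ω → ℝ) (θ : Ω → ℝ) (h : ℝ≥0) (n : ℕ) :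
    Matrix (Fin 4) (Fin 4) ℝ :=
  Matrix.reindex finSumFinEquiv finSumFinEquiv
    (Matrix.fromBlocks (condCov P Y θ h n) (crossCov P Y θ h n) (crossCov P Y θ h n).transpose
      (Matrix.of fun _ _ ↦ Var[fun ω ↦ driftEst Y h n ω ^ 2; P]))

end MixedFBS

end

/-!
The limit law is the Dirac mass at the origin, and the theorem holds because the estimator converges
faster than at the rate `N ^ (-1/2)`.

Write `θ` for the drift of a subject and `Z` for its mixed process on the grid, so that the
observations are `θ k h + Z_k`. A polarization writes each of `ξ`, `η`, `ζ` as a combination of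
averages of squared increments (`momentStat_eq_sum_avgSq`), and each such average is a multiple of
`θ²`, plus `θ` times an average increment of `Z`, plus the same average for `Z` alone
(`avgSq_linear_add`). With `u = (h², h², 4 h², 1)`, called `driftDirection` below, the statistics
`(ξ, η, ζ, θ̂²)` of a subject are therefore `θ² u + c` plus noise, which is centred but for a
vanishing bias of `θ̂²`; here `c` is determined by the variogram of `Z`.

* As `Z` is independent of `θ`, conditioning on `θ` removes the noise exactly, and all the
  covariances in the statement converge to those of `θ² u`: the limit of the matrices is `Var (θ²) u
  uᵀ` (`tendsto_jointCov`), and the limit of the means is `c + E (θ²) u`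
  (`tendsto_integral_avgStat`).
* The estimator depends on the statistics only through the drift-corrected quantities `ξ - h² V`, `η
  - h² V` and `ζ - 4 h² V`, so it is constant along `u` (`estMap_add_smul`). Its Jacobian kills `u`
  (`jacobian_mulVec_driftDirection`), and the covariance matrix of the limit vanishes.
* The corrected statistics, averaged over subjects, differ from `c` by `o(N ^ (-1/2))` in `L¹`
  (`tendstoL1Zero_avgStat`). There are three errors. The average increments over blocks of different
  lengths agree up to boundary terms of size `1 / n`. The averages of squared increments of `Z` have
  mean `c` and a variance that vanishes as `n → ∞`, because the covariances of distant increments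
  vanish (`tendsto_avgSqVar`), and averaging over independent subjects divides this variance by `N`.
  The bias of `θ̂²` is `Var (Z_n - Z_0) / (n h)² = O(n ^ (2H - 2))`, which is `o(n ^ (-1/2))` as `H
  < 3/4`, hence `o(N ^ (-1/2))`.

The estimator is differentiable at `c`, so it inherits this rate (`tendstoInMeasure_sqrt_smul_sub`).
-/

namespace MixedFBS

/-! ### Moments of Gaussian variables -/

section GaussianMoments

lemma integral_pow_four_gaussianReal (v : ℝ≥0) :
    ∫ x, x ^ 4 ∂gaussianReal 0 v = 3 * (v : ℝ) ^ 2 := by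
  -- The moment generating function is `exp (v t² / 2)`; its derivatives are polynomials times it.
  have key : ∀ p p' : ℝ → ℝ, (∀ t, HasDerivAt p (p' t) t) →
      deriv (fun t ↦ p t * Real.exp (v * t ^ 2 / 2)) =
        fun t ↦ (p' t + v * t * p t) * Real.exp (v * t ^ 2 / 2) := by
    intro p p' hp
    ext t
    have h1 : HasDerivAt (fun t : ℝ ↦ (v : ℝ) * t ^ 2 / 2) (v * t) t := by
      have := (((hasDerivAt_id t).pow 2).const_mul (v : ℝ)).div_const 2
      refine this.congr_deriv ?_
      simp; ring
    have := ((hp t).mul h1.exp).deriv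
    refine Eq.trans this ?_
    ring
  have hmgf : mgf (fun x ↦ x) (gaussianReal 0 v) =
      fun t ↦ (fun _ ↦ (1 : ℝ)) t * Real.exp (v * t ^ 2 / 2) := by
    rw [mgf_fun_id_gaussianReal]; simp
  have h0 : ∫ x, x ^ 4 ∂gaussianReal 0 v =
      iteratedDeriv 4 (mgf (fun x ↦ x) (gaussianReal 0 v)) 0 := by
    rw [iteratedDeriv_mgf_zero] <;> simp
  rw [h0, hmgf, iteratedDeriv_succ, iteratedDeriv_succ, iteratedDeriv_succ, iteratedDeriv_one,
    key (fun _ ↦ 1) (fun _ ↦ 0) (fun t ↦ hasDerivAt_const t 1)]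
  simp only [zero_add, mul_one]
  rw [key (fun t ↦ v * t) (fun _ ↦ v)
    (fun t ↦ by simpa using (hasDerivAt_id t).const_mul (v : ℝ))]
  rw [key (fun t ↦ v + v * t * (v * t)) (fun t ↦ 2 * v ^ 2 * t) (fun t ↦ by
    have := (((hasDerivAt_id t).const_mul (v : ℝ)).mul
      ((hasDerivAt_id t).const_mul (v : ℝ))).const_add (v : ℝ)
    refine this.congr_deriv ?_
    simp; ring)]
  rw [key (fun t ↦ 2 * v ^ 2 * t + v * t * (v + v * t * (v * t)))
    (fun t ↦ 3 * v ^ 2 + 3 * v ^ 3 * t ^ 2) (fun t ↦ by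
    have h1 := (hasDerivAt_id t).const_mul (3 * (v : ℝ) ^ 2)
    have h3 := ((hasDerivAt_id t).pow 3).const_mul ((v : ℝ) ^ 3)
    refine ((h1.add h3).congr_deriv (by simp; ring)).congr_of_eventuallyEq ?_
    refine Eventually.of_forall fun x ↦ ?_
    simp; ring)]
  simp

variable {Ω : Type*} [MeasurableSpace Ω] {P : Measure Ω}

lemma integral_pow_four_of_hasGaussianLaw {X : Ω → ℝ} (hX : HasGaussianLaw X P)
    (h0 : ∫ ω, X ω ∂P = 0) : ∫ ω, X ω ^ 4 ∂P = 3 * (∫ ω, X ω ^ 2 ∂P) ^ 2 := by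
  have hm := hX.aemeasurable
  have hv : Var[X; P] = ∫ ω, X ω ^ 2 ∂P := by simp [variance_eq_integral hm, h0]
  have h4 : ∫ ω, X ω ^ 4 ∂P = ∫ x, x ^ 4 ∂(P.map X) := by
    rw [integral_map hm (by fun_prop)]
  rw [h4, hX.map_eq_gaussianReal, h0, integral_pow_four_gaussianReal,
    Real.coe_toNNReal _ (variance_nonneg _ _), hv]

lemma _root_.ProbabilityTheory.HasGaussianLaw.integrable_pow {X : Ω → ℝ}
    (hX : HasGaussianLaw X P) (p : ℕ) : Integrable (fun ω ↦ X ω ^ p) P := by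
  have := hX.isProbabilityMeasure
  have h : MemLp X p P := hX.memLp (by simp)
  refine (integrable_norm_iff (hX.aemeasurable.pow_const p).aestronglyMeasurable).1 ?_
  simpa only [norm_pow] using h.integrable_norm_pow'

lemma memLp_two_sq_of_hasGaussianLaw {X : Ω → ℝ} (hX : HasGaussianLaw X P) :
    MemLp (fun ω ↦ X ω ^ 2) 2 P := by
  refine (memLp_two_iff_integrable_sq (hX.aemeasurable.pow_const 2).aestronglyMeasurable).2 ?_
  simpa [← pow_mul] using hX.integrable_pow 4

/-- The covariance of the squares of a centred Gaussian pair: the only consequence of Wick's formula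
that is needed. It follows from the fourth moments of `X`, `Y`, `X + Y` and `X - Y`. -/
lemma covariance_sq_sq_of_hasGaussianLaw {X Y : Ω → ℝ}
    (hXY : HasGaussianLaw (fun ω ↦ (X ω, Y ω)) P)
    (hX0 : ∫ ω, X ω ∂P = 0) (hY0 : ∫ ω, Y ω ∂P = 0) :
    cov[fun ω ↦ X ω ^ 2, fun ω ↦ Y ω ^ 2; P] = 2 * (∫ ω, X ω * Y ω ∂P) ^ 2 := by
  have := hXY.isProbabilityMeasure
  have hX := hXY.fst
  have hY := hXY.snd
  have hA := hXY.fun_add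
  have hS := hXY.fun_sub
  have hX2 := memLp_two_sq_of_hasGaussianLaw hX
  have hY2 := memLp_two_sq_of_hasGaussianLaw hY
  have iXY : Integrable (fun ω ↦ X ω * Y ω) P := hX.memLp_two.integrable_mul hY.memLp_two
  have iX2Y2 : Integrable (fun ω ↦ X ω ^ 2 * Y ω ^ 2) P := hX2.integrable_mul hY2
  have hA0 : ∫ ω, X ω + Y ω ∂P = 0 := by
    rw [integral_add hX.integrable hY.integrable, hX0, hY0, add_zero]
  have hS0 : ∫ ω, X ω - Y ω ∂P = 0 := by
    rw [integral_sub hX.integrable hY.integrable, hX0, hY0, sub_zero]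
  have iX2 := hX.integrable_pow 2
  have iY2 := hY.integrable_pow 2
  have iX4 := hX.integrable_pow 4
  have iY4 := hY.integrable_pow 4
  have eA2 : ∫ ω, (X ω + Y ω) ^ 2 ∂P =
      ∫ ω, X ω ^ 2 ∂P + 2 * ∫ ω, X ω * Y ω ∂P + ∫ ω, Y ω ^ 2 ∂P := by
    rw [← integral_const_mul, ← integral_add iX2 (iXY.const_mul 2),
      ← integral_add (iX2.fun_add (iXY.const_mul 2)) iY2]
    congr with ω; ring
  have eS2 : ∫ ω, (X ω - Y ω) ^ 2 ∂P =
      ∫ ω, X ω ^ 2 ∂P - 2 * ∫ ω, X ω * Y ω ∂P + ∫ ω, Y ω ^ 2 ∂P := by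
    rw [← integral_const_mul, ← integral_sub iX2 (iXY.const_mul 2),
      ← integral_add (f := fun ω ↦ X ω ^ 2 - 2 * (X ω * Y ω)) (iX2.sub (iXY.const_mul 2)) iY2]
    congr with ω; ring
  have e4 : ∫ ω, (X ω + Y ω) ^ 4 ∂P + ∫ ω, (X ω - Y ω) ^ 4 ∂P =
      2 * ∫ ω, X ω ^ 4 ∂P + 12 * ∫ ω, X ω ^ 2 * Y ω ^ 2 ∂P + 2 * ∫ ω, Y ω ^ 4 ∂P := by
    rw [← integral_const_mul, ← integral_const_mul, ← integral_const_mul,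
      ← integral_add (iX4.const_mul 2) (iX2Y2.const_mul 12),
      ← integral_add ((iX4.const_mul 2).fun_add (iX2Y2.const_mul 12)) (iY4.const_mul 2),
      ← integral_add (hA.integrable_pow 4) (hS.integrable_pow 4)]
    congr with ω; ring
  rw [integral_pow_four_of_hasGaussianLaw hA hA0, integral_pow_four_of_hasGaussianLaw hS hS0,
    integral_pow_four_of_hasGaussianLaw hX hX0, integral_pow_four_of_hasGaussianLaw hY hY0,
    eA2, eS2] at e4
  rw [covariance_eq_sub hX2 hY2]
  simp only [Pi.mul_apply]
  linarith

/-! ### Gaussian sequences with stationary increments -/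

/-- `Z` is a random sequence with centred, jointly Gaussian increments of variance `E (Z_k - Z_l)² =
V (k - l)`. The variogram `V` lives on `ℤ`, so that the covariance of two increments is a second
difference of `V` whatever the order of the indices. Nothing is asked of `Z 0`. -/
structure IsGaussianNoise (P : Measure Ω) (V : ℤ → ℝ) (Z : ℕ → Ω → ℝ) : Prop where
  measurable : ∀ k, Measurable (Z k)
  hasGaussianLaw : ∀ k l a b : ℕ,
    HasGaussianLaw (fun ω ↦ (Z k ω - Z l ω, Z a ω - Z b ω)) P
  centred : ∀ k l : ℕ, ∫ ω, Z k ω - Z l ω ∂P = 0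
  variogram : ∀ k l : ℕ, ∫ ω, (Z k ω - Z l ω) ^ 2 ∂P = V (k - l)

namespace IsGaussianNoise

variable {V : ℤ → ℝ} {Z : ℕ → Ω → ℝ}

lemma hasGaussianLaw_sub (hZ : IsGaussianNoise P V Z) (k l : ℕ) :
    HasGaussianLaw (fun ω ↦ Z k ω - Z l ω) P :=
  (hZ.hasGaussianLaw k l k l).fst

lemma even (hZ : IsGaussianNoise P V Z) (d : ℤ) : V (-d) = V d := by
  obtain ⟨n, rfl | rfl⟩ := d.eq_nat_or_neg
  · have h1 := hZ.variogram 0 n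
    have h2 := hZ.variogram n 0
    simp only [Nat.cast_zero, zero_sub, sub_zero] at h1 h2
    rw [← h1, ← h2]
    congr with ω; ring
  · have h1 := hZ.variogram 0 n
    have h2 := hZ.variogram n 0
    simp only [Nat.cast_zero, zero_sub, sub_zero] at h1 h2
    rw [neg_neg, ← h1, ← h2]
    congr with ω; ring

lemma variogram_nonneg (hZ : IsGaussianNoise P V Z) (n : ℕ) : 0 ≤ V n := by
  have := hZ.variogram n 0
  simp only [Nat.cast_zero, sub_zero] at this
  rw [← this]
  positivity

/-- Polarization: increments over blocks of length `j` at distance `d` have covariance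
`(V (d + j) + V (d - j) - 2 V d) / 2`. -/
lemma integral_increment_mul (hZ : IsGaussianNoise P V Z) (j k l : ℕ) :
    ∫ ω, (Z (k + j) ω - Z k ω) * (Z (l + j) ω - Z l ω) ∂P =
      (V ((l : ℤ) - k + j) + V ((l : ℤ) - k - j) - 2 * V ((l : ℤ) - k)) / 2 := by
  have i := fun a b ↦ (hZ.hasGaussianLaw_sub a b).integrable_pow 2
  have e1 := hZ.variogram (l + j) k
  have e2 := hZ.variogram l (k + j)
  have e3 := hZ.variogram (l + j) (k + j)
  have e4 := hZ.variogram l k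
  have r1 : ((l + j : ℕ) : ℤ) - k = (l : ℤ) - k + j := by push_cast; ring
  have r2 : (l : ℤ) - (k + j : ℕ) = (l : ℤ) - k - j := by push_cast; ring
  have r3 : ((l + j : ℕ) : ℤ) - (k + j : ℕ) = (l : ℤ) - k := by push_cast; ring
  rw [r1] at e1
  rw [r2] at e2
  rw [r3] at e3
  have : V ((l : ℤ) - k + j) + V ((l : ℤ) - k - j) - 2 * V ((l : ℤ) - k) =
      2 * ∫ ω, (Z (k + j) ω - Z k ω) * (Z (l + j) ω - Z l ω) ∂P := by
    rw [two_mul (V _), ← sub_sub]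
    nth_rw 1 [← e3]
    rw [← e1, ← e2, ← e4, ← integral_const_mul, ← integral_add (i _ _) (i _ _),
      ← integral_sub ((i _ _).fun_add (i _ _)) (i _ _),
      ← integral_sub (f := fun ω ↦ (Z (l + j) ω - Z k ω) ^ 2 + (Z l ω - Z (k + j) ω) ^ 2 -
        (Z (l + j) ω - Z (k + j) ω) ^ 2) (((i _ _).fun_add (i _ _)).sub (i _ _)) (i _ _)]
    congr with ω; ring
  rw [this]; ring

end IsGaussianNoise

end GaussianMoments

/-! ### The variogram of the mixed process -/

section QuadraticVariation

/-- The variance `a |d| + b |d| ^ p` of the increment over `d` steps of the mixed process sampled on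
a grid; in the model `a = σ² h`, `b = γ² h ^ 2H` and `p = 2H`. -/
noncomputable def mixedVariogram (a b p : ℝ) (d : ℤ) : ℝ := a * |(d : ℝ)| + b * |(d : ℝ)| ^ p

/-- The mean value theorem, applied to `t ↦ (x + t) ^ p + (x - t) ^ p` on `[0, j]` and then to
`y ↦ y ^ (p - 1)`. -/
lemma abs_rpow_second_difference_le {p x j : ℝ} (hp1 : 1 < p) (hp2 : p < 2) (hj : 0 < j)
    (hx : j < x) :
    |(x + j) ^ p + (x - j) ^ p - 2 * x ^ p| ≤ 2 * j ^ 2 * p * (p - 1) * (x - j) ^ (p - 2) := by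
  have hF : ∀ t ∈ Set.Icc 0 j, HasDerivAt (fun t ↦ (x + t) ^ p + (x - t) ^ p)
      (p * (x + t) ^ (p - 1) - p * (x - t) ^ (p - 1)) t := by
    intro t ht
    have h1 := ((hasDerivAt_id t).const_add x).rpow_const (p := p) (Or.inr hp1.le)
    have h2 := ((hasDerivAt_id t).const_sub x).rpow_const (p := p) (Or.inr hp1.le)
    refine (h1.add h2).congr_deriv ?_
    simp; ring
  obtain ⟨c, hc, hc'⟩ := exists_hasDerivAt_eq_slope (fun t ↦ (x + t) ^ p + (x - t) ^ p) _ hj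
    (fun t ht ↦ (hF t ht).continuousAt.continuousWithinAt)
    (fun t ht ↦ hF t (Set.Ioo_subset_Icc_self ht))
  have hG : ∀ y ∈ Set.Icc (x - c) (x + c), HasDerivAt (fun y : ℝ ↦ y ^ (p - 1))
      ((p - 1) * y ^ (p - 1 - 1)) y := fun y hy ↦
    Real.hasDerivAt_rpow_const (Or.inl (by linarith [hy.1, hc.2]))
  obtain ⟨y, hy, hy'⟩ := exists_hasDerivAt_eq_slope (fun y : ℝ ↦ y ^ (p - 1)) _
    (show x - c < x + c by linarith [hc.1])
    (fun t ht ↦ (hG t ht).continuousAt.continuousWithinAt)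
    (fun t ht ↦ hG t (Set.Ioo_subset_Icc_self ht))
  have hc0 := hc.1
  have hcj := hc.2
  have e1 : (x + j) ^ p + (x - j) ^ p - 2 * x ^ p =
      j * (p * ((2 * c) * ((p - 1) * y ^ (p - 2)))) := by
    have h1 : (x + c) ^ (p - 1) - (x - c) ^ (p - 1) = (2 * c) * ((p - 1) * y ^ (p - 2)) := by
      rw [show p - 2 = p - 1 - 1 by ring, hy', show x + c - (x - c) = 2 * c by ring]
      field_simp
    rw [← h1, mul_sub, hc', sub_zero x, sub_zero j, mul_div_cancel₀ _ hj.ne']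
    simp
    ring
  have hpos : 0 < x - j := by linarith
  have hyp : y ^ (p - 2) ≤ (x - j) ^ (p - 2) :=
    Real.rpow_le_rpow_of_nonpos hpos (by linarith [hy.1]) (by linarith)
  have hy0 : 0 ≤ y ^ (p - 2) := Real.rpow_nonneg (by linarith [hy.1]) _
  have hp3 : 0 < p - 1 := by linarith
  rw [e1, abs_of_nonneg (by positivity)]
  calc j * (p * ((2 * c) * ((p - 1) * y ^ (p - 2))))
      ≤ j * (p * ((2 * j) * ((p - 1) * (x - j) ^ (p - 2)))) := by gcongr
    _ = _ := by ring

/-- The correlation of distant increments vanishes. -/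
lemma tendsto_mixedVariogram_second_difference {a b p : ℝ} (hp1 : 1 < p) (hp2 : p < 2) (j : ℕ) :
    Tendsto (fun d : ℕ ↦ (mixedVariogram a b p (d + j) + mixedVariogram a b p (d - j) -
      2 * mixedVariogram a b p d) / 2) atTop (𝓝 0) := by
  rcases Nat.eq_zero_or_pos j with rfl | hj
  · refine tendsto_const_nhds.congr fun d ↦ ?_
    simp; ring
  have hj' : (0 : ℝ) < j := by exact_mod_cast hj
  have hlim : Tendsto (fun d : ℕ ↦ |b| / 2 * (2 * (j : ℝ) ^ 2 * p * (p - 1) *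
      ((d : ℝ) - j) ^ (p - 2))) atTop (𝓝 0) := by
    have h1 : Tendsto (fun d : ℕ ↦ (d : ℝ) - j) atTop atTop :=
      tendsto_atTop_add_const_right _ _ tendsto_natCast_atTop_atTop
    have h2 := (tendsto_rpow_neg_atTop (y := 2 - p) (by linarith)).comp h1
    have h3 := (h2.const_mul (2 * (j : ℝ) ^ 2 * p * (p - 1))).const_mul (|b| / 2)
    simpa [Function.comp_def] using h3
  refine squeeze_zero_norm' ?_ hlim
  filter_upwards [eventually_gt_atTop j] with d hd
  have hd' : (j : ℝ) < d := by exact_mod_cast hd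
  have key := abs_rpow_second_difference_le hp1 hp2 hj' hd'
  have e : (mixedVariogram a b p (d + j) + mixedVariogram a b p (d - j) -
      2 * mixedVariogram a b p d) / 2 =
      b / 2 * (((d : ℝ) + j) ^ p + ((d : ℝ) - j) ^ p - 2 * (d : ℝ) ^ p) := by
    unfold mixedVariogram
    push_cast
    rw [abs_of_nonneg (show (0 : ℝ) ≤ (d : ℝ) + j by positivity),
      abs_of_nonneg (show (0 : ℝ) ≤ (d : ℝ) - j by linarith),
      abs_of_nonneg (show (0 : ℝ) ≤ (d : ℝ) by positivity)]
    ring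
  rw [e, Real.norm_eq_abs, abs_mul, abs_div, abs_two]
  gcongr

/-- The bias of the squared drift estimator is `o(n ^ (-1/2))`. This is where `H < 3/4` enters. -/
lemma tendsto_sqrt_mul_mixedVariogram_div_sq {a b p : ℝ} (hp : p < 3 / 2) :
    Tendsto (fun n : ℕ ↦ √(n : ℝ) * (mixedVariogram a b p n / (n : ℝ) ^ 2)) atTop (𝓝 0) := by
  have h1 := (tendsto_rpow_neg_atTop (y := 1 / 2) (by norm_num)).comp
    (tendsto_natCast_atTop_atTop (R := ℝ))
  have h2 := (tendsto_rpow_neg_atTop (y := 3 / 2 - p) (by linarith)).comp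
    (tendsto_natCast_atTop_atTop (R := ℝ))
  have h3 := (h1.const_mul a).add (h2.const_mul b)
  simp only [mul_zero, add_zero] at h3
  refine h3.congr' ?_
  filter_upwards [eventually_gt_atTop 0] with n hn
  have hn' : (0 : ℝ) < n := by exact_mod_cast hn
  have e1 : (n : ℝ) ^ (-(1 / 2) : ℝ) = (n : ℝ) ^ (1 / 2 : ℝ) * n / (n : ℝ) ^ 2 := by
    rw [eq_div_iff (by positivity), ← Real.rpow_natCast, ← Real.rpow_add hn',
      ← Real.rpow_add_one hn'.ne']
    norm_num
  have e2 : (n : ℝ) ^ (-(3 / 2 - p) : ℝ) = (n : ℝ) ^ (1 / 2 : ℝ) * (n : ℝ) ^ p / (n : ℝ) ^ 2 := by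
    rw [eq_div_iff (by positivity), ← Real.rpow_natCast, ← Real.rpow_add hn',
      ← Real.rpow_add hn']
    congr 1
    push_cast
    ring
  simp only [Function.comp_apply, mixedVariogram, e1, e2, Real.sqrt_eq_rpow, Int.cast_natCast,
    Nat.abs_cast]
  ring

/-! ### Averages of squared increments -/

/-- A double sum over differences of indices is at most `2 n` times a single sum: by induction, the
step from `n` to `n + 1` adds a row and a column. -/
lemma sum_sum_range_sub_le {f : ℤ → ℝ} (hf : ∀ d, 0 ≤ f d) (heven : ∀ d, f (-d) = f d) (n : ℕ) :
    ∑ k ∈ Finset.range n, ∑ l ∈ Finset.range n, f ((l : ℤ) - k) ≤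
      2 * n * ∑ d ∈ Finset.range n, f d := by
  induction n with
  | zero => simp
  | succ n ih =>
    have hcol : ∑ k ∈ Finset.range n, f ((n : ℤ) - k) + f 0 =
        ∑ d ∈ Finset.range (n + 1), f d := by
      rw [← Finset.sum_range_reflect (fun d : ℕ ↦ f d), Finset.sum_range_succ]
      congr 1
      · refine Finset.sum_congr rfl fun k hk ↦ ?_
        rw [Finset.mem_range] at hk
        congr 1
        omega
      · congr 1
        omega
    have hrow : ∑ l ∈ Finset.range n, f ((l : ℤ) - n) = ∑ k ∈ Finset.range n, f ((n : ℤ) - k) :=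
      Finset.sum_congr rfl fun k _ ↦ by rw [← heven, neg_sub]
    have hstep : ∑ k ∈ Finset.range (n + 1), ∑ l ∈ Finset.range (n + 1), f ((l : ℤ) - k) =
        ∑ k ∈ Finset.range n, ∑ l ∈ Finset.range n, f ((l : ℤ) - k) +
          2 * ∑ d ∈ Finset.range (n + 1), f d - f 0 := by
      simp only [Finset.sum_range_succ _ n, Finset.sum_add_distrib, hrow] at hcol ⊢
      simp only [sub_self]
      linarith
    have hmono : ∑ d ∈ Finset.range n, f d ≤ ∑ d ∈ Finset.range (n + 1), f d := by
      rw [Finset.sum_range_succ]; linarith [hf n]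
    rw [hstep]
    push_cast
    nlinarith [hf 0, mul_le_mul_of_nonneg_left hmono (show (0 : ℝ) ≤ 2 * n by positivity)]

/-- The average of the squared increments of a sequence over the `n` blocks
`[k + s, k + s + j]`, `k < n`. -/
noncomputable def avgSq (j s n : ℕ) (z : ℕ → ℝ) : ℝ :=
  (1 / n) * ∑ k ∈ Finset.range n, (z (k + s + j) - z (k + s)) ^ 2

/-- The covariance of two increments over blocks of length `j` at distance `d`, in terms of the
variogram. -/
noncomputable def incrCov (V : ℤ → ℝ) (j : ℕ) (d : ℤ) : ℝ := (V (d + j) + V (d - j) - 2 * V d) / 2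

/-- The variance of `avgSq j s n` for a Gaussian sequence with variogram `V`. -/
noncomputable def avgSqVar (V : ℤ → ℝ) (j n : ℕ) : ℝ :=
  (1 / n) ^ 2 * ∑ k ∈ Finset.range n, ∑ l ∈ Finset.range n, 2 * incrCov V j ((l : ℤ) - k) ^ 2

lemma tendsto_avgSqVar {V : ℤ → ℝ} (heven : ∀ d, V (-d) = V d) (j : ℕ)
    (hV : Tendsto (fun d : ℕ ↦ incrCov V j d) atTop (𝓝 0)) :
    Tendsto (avgSqVar V j) atTop (𝓝 0) := by
  have hev : ∀ d, 2 * incrCov V j (-d) ^ 2 = 2 * incrCov V j d ^ 2 := by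
    intro d
    unfold incrCov
    rw [heven d, show -d + (j : ℤ) = -(d - j) by ring, show -d - (j : ℤ) = -(d + j) by ring,
      heven, heven]
    ring
  have hlim : Tendsto (fun n : ℕ ↦
      2 * ((n : ℝ)⁻¹ * ∑ d ∈ Finset.range n, 2 * incrCov V j d ^ 2)) atTop (𝓝 0) := by
    have h1 : Tendsto (fun d : ℕ ↦ 2 * incrCov V j d ^ 2) atTop (𝓝 0) := by
      simpa using (hV.pow 2).const_mul 2
    simpa using h1.cesaro.const_mul 2
  refine squeeze_zero (fun n ↦ by unfold avgSqVar; positivity) (fun n ↦ ?_) hlim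
  have := sum_sum_range_sub_le (f := fun d ↦ 2 * incrCov V j d ^ 2) (fun d ↦ by positivity) hev n
  rcases Nat.eq_zero_or_pos n with rfl | hn
  · simp [avgSqVar]
  have hn' : (0 : ℝ) < n := by exact_mod_cast hn
  calc avgSqVar V j n ≤ (1 / n) ^ 2 * (2 * n * ∑ d ∈ Finset.range n, 2 * incrCov V j d ^ 2) := by
        unfold avgSqVar; gcongr
    _ = _ := by field_simp

variable {Ω : Type*} [MeasurableSpace Ω] {P : Measure Ω} {V : ℤ → ℝ} {Z : ℕ → Ω → ℝ}

@[fun_prop]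
lemma measurable_avgSq (j s n : ℕ) : Measurable (avgSq j s n) := by
  unfold avgSq; fun_prop

namespace IsGaussianNoise

lemma measurable_path (hZ : IsGaussianNoise P V Z) : Measurable fun ω k ↦ Z k ω :=
  measurable_pi_lambda _ hZ.measurable

lemma memLp_avgSq (hZ : IsGaussianNoise P V Z) (j s n : ℕ) :
    MemLp (fun ω ↦ avgSq j s n (Z · ω)) 2 P :=
  (memLp_finsetSum _ fun k _ ↦
    memLp_two_sq_of_hasGaussianLaw (hZ.hasGaussianLaw_sub (k + s + j) (k + s))).const_mul _

lemma integral_avgSq (hZ : IsGaussianNoise P V Z) (j s : ℕ) {n : ℕ} (hn : 0 < n) :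
    ∫ ω, avgSq j s n (Z · ω) ∂P = V j := by
  have hn' : (n : ℝ) ≠ 0 := by exact_mod_cast hn.ne'
  unfold avgSq
  rw [integral_const_mul, integral_finsetSum _ fun k _ ↦
    (hZ.hasGaussianLaw_sub (k + s + j) (k + s)).integrable_pow 2]
  have : ∀ k : ℕ, ∫ ω, (Z (k + s + j) ω - Z (k + s) ω) ^ 2 ∂P = V j := by
    intro k
    rw [hZ.variogram]
    congr 1
    push_cast; ring
  simp only [this, Finset.sum_const, Finset.card_range, nsmul_eq_mul]
  field_simp

lemma variance_avgSq (hZ : IsGaussianNoise P V Z) (j s n : ℕ) :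
    Var[fun ω ↦ avgSq j s n (Z · ω); P] = avgSqVar V j n := by
  have := (hZ.hasGaussianLaw_sub 0 0).isProbabilityMeasure
  unfold avgSq
  rw [variance_const_mul, variance_fun_sum' fun k _ ↦
    memLp_two_sq_of_hasGaussianLaw (hZ.hasGaussianLaw_sub (k + s + j) (k + s)), avgSqVar]
  congr 1
  refine Finset.sum_congr rfl fun k _ ↦ Finset.sum_congr rfl fun l _ ↦ ?_
  rw [covariance_sq_sq_of_hasGaussianLaw (hZ.hasGaussianLaw _ _ _ _) (hZ.centred _ _)
    (hZ.centred _ _), hZ.integral_increment_mul, incrCov]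
  have : ((l + s : ℕ) : ℤ) - (k + s : ℕ) = (l : ℤ) - k := by push_cast; ring
  rw [this]

end IsGaussianNoise

end QuadraticVariation

/-! ### One subject: a random drift plus Gaussian noise -/

section OneSubject

/-- The average of the increments of a sequence over the `n` blocks `[k + s, k + s + j]`, `k < n`.
-/
noncomputable def avgInc (j s n : ℕ) (z : ℕ → ℝ) : ℝ :=
  (1 / n) * ∑ k ∈ Finset.range n, (z (k + s + j) - z (k + s))

@[fun_prop]
lemma measurable_avgInc (j s n : ℕ) : Measurable (avgInc j s n) := by
  unfold avgInc; fun_prop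

lemma avgSq_linear_add {n : ℕ} (hn : 0 < n) (j s : ℕ) (t h : ℝ) (z : ℕ → ℝ) :
    avgSq j s n (fun k ↦ t * (k * h) + z k) =
      (j * h) ^ 2 * t ^ 2 + 2 * (j * h) * (t * avgInc j s n z) + avgSq j s n z := by
  have hn' : (n : ℝ) ≠ 0 := by exact_mod_cast hn.ne'
  have : ∀ k : ℕ, (t * ((k + s + j : ℕ) * h) + z (k + s + j) -
      (t * ((k + s : ℕ) * h) + z (k + s))) ^ 2 =
      (j * h) ^ 2 * t ^ 2 + 2 * (j * h) * t * (z (k + s + j) - z (k + s)) +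
        (z (k + s + j) - z (k + s)) ^ 2 := by
    intro k; push_cast; ring
  simp only [avgSq, avgInc, this, Finset.sum_add_distrib, Finset.sum_const, Finset.card_range,
    nsmul_eq_mul, ← Finset.mul_sum]
  field_simp

/-- Up to a boundary term of order `1 / n`, the average increment over blocks of length `j` is `j`
times the average increment over unit blocks. -/
lemma avgInc_sub_mul {n : ℕ} (j s : ℕ) (z : ℕ → ℝ) :
    avgInc j s n z - j * ((z n - z 0) / n) =
      (1 / n) * ∑ i ∈ Finset.range j, ((z (n + (s + i)) - z n) - (z (s + i) - z 0)) := by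
  have key : ∑ k ∈ Finset.range n, (z (k + s + j) - z (k + s)) =
      ∑ i ∈ Finset.range j, (z (n + (s + i)) - z (s + i)) := by
    induction j with
    | zero => simp
    | succ j ih =>
      rw [Finset.sum_range_succ, ← ih]
      have htel : ∑ k ∈ Finset.range n, (z (k + 1 + (s + j)) - z (k + (s + j))) =
          z (n + (s + j)) - z (s + j) := by
        simpa using Finset.sum_range_sub (fun k ↦ z (k + (s + j))) n
      rw [← htel, ← Finset.sum_add_distrib]
      refine Finset.sum_congr rfl fun k _ ↦ ?_
      rw [show k + s + (j + 1) = k + 1 + (s + j) by ring, show k + s + j = k + (s + j) by ring]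
      ring
  have : ∀ i, (z (n + (s + i)) - z n) - (z (s + i) - z 0) =
      (z (n + (s + i)) - z (s + i)) - (z n - z 0) := fun i ↦ by ring
  simp only [avgInc, key, this, Finset.sum_sub_distrib, Finset.sum_const, Finset.card_range,
    nsmul_eq_mul]
  ring

/-- The observations `θ k h + Z_k` of a subject, as a sequence. -/
def driftPath {Ω : Type*} (h : ℝ) (θ : Ω → ℝ) (Z : ℕ → Ω → ℝ) (ω : Ω)
    (k : ℕ) : ℝ := θ ω * (k * h) + Z k ω

lemma avgSq_driftPath {Ω : Type*} {θ : Ω → ℝ} {Z : ℕ → Ω → ℝ} {n : ℕ} (hn : 0 < n)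
    (j s : ℕ) (h : ℝ) (ω : Ω) :
    avgSq j s n (driftPath h θ Z ω) = (j * h) ^ 2 * θ ω ^ 2 +
      2 * (j * h) * (θ ω * avgInc j s n (Z · ω)) + avgSq j s n (Z · ω) :=
  avgSq_linear_add hn j s (θ ω) h (Z · ω)

variable {Ω : Type*} [MeasurableSpace Ω] {P : Measure Ω} {V : ℤ → ℝ} {θ : Ω → ℝ} {Z : ℕ → Ω → ℝ}

namespace IsGaussianNoise

lemma memLp_sub (hZ : IsGaussianNoise P V Z) (k l : ℕ) :
    MemLp (fun ω ↦ Z k ω - Z l ω) 2 P :=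
  (hZ.hasGaussianLaw_sub k l).memLp_two

lemma memLp_avgInc (hZ : IsGaussianNoise P V Z) (j s n : ℕ) :
    MemLp (fun ω ↦ avgInc j s n (Z · ω)) 2 P :=
  (memLp_finsetSum _ fun _ _ ↦ hZ.memLp_sub _ _).const_mul _

lemma isProbabilityMeasure (hZ : IsGaussianNoise P V Z) : IsProbabilityMeasure P :=
  (hZ.hasGaussianLaw_sub 0 0).isProbabilityMeasure

lemma integrable_sub (hZ : IsGaussianNoise P V Z) (k l : ℕ) :
    Integrable (fun ω ↦ Z k ω - Z l ω) P :=
  (hZ.hasGaussianLaw_sub k l).integrable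

lemma integral_avgInc (hZ : IsGaussianNoise P V Z) (j s n : ℕ) :
    ∫ ω, avgInc j s n (Z · ω) ∂P = 0 := by
  unfold avgInc
  rw [integral_const_mul, integral_finsetSum _ fun _ _ ↦ hZ.integrable_sub _ _]
  simp [hZ.centred]

lemma integral_abs_sub_le (hZ : IsGaussianNoise P V Z) (k l : ℕ) :
    ∫ ω, |Z (k + l) ω - Z k ω| ∂P ≤ 1 + V l := by
  have := hZ.isProbabilityMeasure
  have h2 := (hZ.hasGaussianLaw_sub (k + l) k).integrable_pow 2
  calc ∫ ω, |Z (k + l) ω - Z k ω| ∂P ≤ ∫ ω, (1 + (Z (k + l) ω - Z k ω) ^ 2) ∂P := by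
        refine integral_mono (hZ.integrable_sub _ _).abs ((integrable_const 1).add h2) fun ω ↦ ?_
        nlinarith [sq_nonneg (|Z (k + l) ω - Z k ω| - 1), sq_abs (Z (k + l) ω - Z k ω),
          abs_nonneg (Z (k + l) ω - Z k ω)]
    _ = 1 + V l := by
        rw [integral_add (integrable_const 1) h2, hZ.variogram]
        simp

lemma integral_abs_avgInc_sub_le (hZ : IsGaussianNoise P V Z) (j s n : ℕ) :
    ∫ ω, |avgInc j s n (Z · ω) - j * ((Z n ω - Z 0 ω) / n)| ∂P ≤
      (1 / n) * ∑ i ∈ Finset.range j, 2 * (1 + V (s + i : ℕ)) := by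
  have hi : ∀ i, Integrable (fun ω ↦ |Z (n + (s + i)) ω - Z n ω| + |Z (0 + (s + i)) ω - Z 0 ω|) P :=
    fun i ↦ (hZ.integrable_sub _ _).abs.add (hZ.integrable_sub _ _).abs
  calc ∫ ω, |avgInc j s n (Z · ω) - j * ((Z n ω - Z 0 ω) / n)| ∂P
      ≤ ∫ ω, (1 / n) * ∑ i ∈ Finset.range j,
          (|Z (n + (s + i)) ω - Z n ω| + |Z (0 + (s + i)) ω - Z 0 ω|) ∂P := by
        refine integral_mono_of_nonneg (Eventually.of_forall fun ω ↦ abs_nonneg _)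
          ((integrable_finsetSum _ fun i _ ↦ hi i).const_mul _)
          (Eventually.of_forall fun ω ↦ ?_)
        dsimp only
        rw [avgInc_sub_mul, abs_mul, abs_of_nonneg (by positivity : (0 : ℝ) ≤ 1 / n)]
        gcongr
        refine (Finset.abs_sum_le_sum_abs _ _).trans (Finset.sum_le_sum fun i _ ↦ ?_)
        rw [zero_add]
        exact abs_sub _ _
    _ ≤ _ := by
        rw [integral_const_mul, integral_finsetSum _ fun i _ ↦ hi i]
        gcongr with i
        rw [integral_add (hZ.integrable_sub _ _).abs (hZ.integrable_sub _ _).abs]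
        linarith [hZ.integral_abs_sub_le n (s + i), hZ.integral_abs_sub_le 0 (s + i)]

end IsGaussianNoise

/-- A subject of the model on the sampling grid: a random drift `θ` with four moments, independent
of a Gaussian noise `Z` with variogram `V`. -/
structure IsSubject (P : Measure Ω) (V : ℤ → ℝ) (θ : Ω → ℝ) (Z : ℕ → Ω → ℝ) : Prop where
  noise : IsGaussianNoise P V Z
  measurable_drift : Measurable θ
  integrable_drift : Integrable (fun ω ↦ θ ω ^ 4) P
  indep : IndepFun θ (fun ω k ↦ Z k ω) P

namespace IsSubject

lemma memLp_drift_sq (hS : IsSubject P V θ Z) : MemLp (fun ω ↦ θ ω ^ 2) 2 P := by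
  refine (memLp_two_iff_integrable_sq
    (hS.measurable_drift.pow_const 2).aestronglyMeasurable).2 ?_
  simpa [← pow_mul] using hS.integrable_drift

lemma memLp_drift (hS : IsSubject P V θ Z) : MemLp θ 2 P := by
  have := hS.noise.isProbabilityMeasure
  exact (memLp_two_iff_integrable_sq hS.measurable_drift.aestronglyMeasurable).2
    (hS.memLp_drift_sq.integrable one_le_two)

lemma integrable_drift_sq (hS : IsSubject P V θ Z) : Integrable (fun ω ↦ θ ω ^ 2) P :=
  hS.memLp_drift.integrable_sq

lemma indepFun_comp (hS : IsSubject P V θ Z) {f : ℝ → ℝ} {g : (ℕ → ℝ) → ℝ} (hf : Measurable f)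
    (hg : Measurable g) : IndepFun (fun ω ↦ f (θ ω)) (fun ω ↦ g (Z · ω)) P :=
  hS.indep.comp hf hg

lemma integral_comp_mul (hS : IsSubject P V θ Z) {f : ℝ → ℝ} {g : (ℕ → ℝ) → ℝ}
    (hf : Measurable f) (hg : Measurable g) :
    ∫ ω, f (θ ω) * g (Z · ω) ∂P = (∫ ω, f (θ ω) ∂P) * ∫ ω, g (Z · ω) ∂P :=
  hS.indep.integral_fun_comp_mul_comp hS.measurable_drift.aemeasurable
    hS.noise.measurable_path.aemeasurable hf.aestronglyMeasurable hg.aestronglyMeasurable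

lemma memLp_drift_mul (hS : IsSubject P V θ Z) {g : (ℕ → ℝ) → ℝ} (hg : Measurable g)
    (hg2 : MemLp (fun ω ↦ g (Z · ω)) 2 P) : MemLp (fun ω ↦ θ ω * g (Z · ω)) 2 P := by
  refine (memLp_two_iff_integrable_sq (hS.measurable_drift.mul
    (hg.comp hS.noise.measurable_path)).aestronglyMeasurable).2 ?_
  have := (hS.indepFun_comp (f := fun x ↦ x ^ 2) (g := fun z ↦ g z ^ 2) (by fun_prop)
    (hg.pow_const 2)).integrable_mul hS.integrable_drift_sq hg2.integrable_sq
  refine this.congr (Eventually.of_forall fun ω ↦ ?_)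
  simp [mul_pow]

lemma integrable_drift_mul_avgInc (hS : IsSubject P V θ Z) (j s n : ℕ) :
    Integrable (fun ω ↦ θ ω * avgInc j s n (Z · ω)) P :=
  hS.memLp_drift.integrable_mul (hS.noise.memLp_avgInc j s n)

lemma memLp_avgSq_driftPath (hS : IsSubject P V θ Z) {n : ℕ} (hn : 0 < n) (j s : ℕ) (h : ℝ) :
    MemLp (fun ω ↦ avgSq j s n (driftPath h θ Z ω)) 2 P := by
  simp only [avgSq_driftPath hn]
  exact ((hS.memLp_drift_sq.const_mul _).add ((hS.memLp_drift_mul (measurable_avgInc j s n)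
    (hS.noise.memLp_avgInc j s n)).const_mul _)).add (hS.noise.memLp_avgSq j s n)

lemma integral_avgSq_driftPath (hS : IsSubject P V θ Z) {n : ℕ} (hn : 0 < n) (j s : ℕ) (h : ℝ) :
    ∫ ω, avgSq j s n (driftPath h θ Z ω) ∂P = (j * h) ^ 2 * ∫ ω, θ ω ^ 2 ∂P + V j := by
  have := hS.noise.isProbabilityMeasure
  have h0 : ∫ ω, θ ω * avgInc j s n (Z · ω) ∂P = 0 := by
    rw [hS.integral_comp_mul (f := fun x ↦ x) measurable_id (measurable_avgInc j s n),
      hS.noise.integral_avgInc, mul_zero]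
  simp only [avgSq_driftPath hn]
  rw [integral_add _ ((hS.noise.memLp_avgSq j s n).integrable one_le_two),
    integral_add (hS.integrable_drift_sq.const_mul _)
      ((hS.integrable_drift_mul_avgInc j s n).const_mul _), integral_const_mul, integral_const_mul,
    h0, hS.noise.integral_avgSq j s hn]
  · ring
  · exact (hS.integrable_drift_sq.const_mul _).add
      ((hS.integrable_drift_mul_avgInc j s n).const_mul _)

/-- Given the drift, the noise averages out exactly. -/
lemma condExp_avgSq_driftPath (hS : IsSubject P V θ Z) {n : ℕ} (hn : 0 < n) (j s : ℕ) (h : ℝ) :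
    P[fun ω ↦ avgSq j s n (driftPath h θ Z ω) | MeasurableSpace.comap θ inferInstance] =ᵐ[P]
      fun ω ↦ (j * h) ^ 2 * θ ω ^ 2 + V j := by
  have := hS.noise.isProbabilityMeasure
  have hm : MeasurableSpace.comap θ inferInstance ≤ (inferInstance : MeasurableSpace Ω) :=
    hS.measurable_drift.comap_le
  have hθm : StronglyMeasurable[MeasurableSpace.comap θ inferInstance] θ :=
    (comap_measurable θ).stronglyMeasurable
  have hind : ∀ {g : (ℕ → ℝ) → ℝ}, Measurable g →
      P[fun ω ↦ g (Z · ω) | MeasurableSpace.comap θ inferInstance] =ᵐ[P]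
        fun _ ↦ ∫ ω, g (Z · ω) ∂P := by
    intro g hg
    refine condExp_indep_eq hS.noise.measurable_path.comap_le hm
      (hg.comp (comap_measurable fun ω k ↦ Z k ω)).stronglyMeasurable ?_
    exact (IndepFun_iff_Indep _ _ _).1 hS.indep.symm
  have e1 : P[fun ω ↦ (j * h) ^ 2 * θ ω ^ 2 | MeasurableSpace.comap θ inferInstance] =
      fun ω ↦ (j * h) ^ 2 * θ ω ^ 2 :=
    condExp_of_stronglyMeasurable hm ((hθm.pow 2).const_mul _)
      (hS.integrable_drift_sq.const_mul _)
  have e2 : P[θ * fun ω ↦ avgInc j s n (Z · ω) |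
      MeasurableSpace.comap θ inferInstance] =ᵐ[P] 0 := by
    refine (condExp_mul_of_stronglyMeasurable_left hθm (hS.integrable_drift_mul_avgInc j s n)
      ((hS.noise.memLp_avgInc j s n).integrable one_le_two)).trans ?_
    filter_upwards [hind (measurable_avgInc j s n)] with ω hω
    simp [hω, hS.noise.integral_avgInc]
  have e3 := hind (measurable_avgSq j s n)
  rw [hS.noise.integral_avgSq j s hn] at e3
  have hfun : (fun ω ↦ avgSq j s n (driftPath h θ Z ω)) = (fun ω ↦ (j * h) ^ 2 * θ ω ^ 2) +
      (2 * (j * h)) • (θ * fun ω ↦ avgInc j s n (Z · ω)) + fun ω ↦ avgSq j s n (Z · ω) := by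
    ext ω; simp [avgSq_driftPath hn]
  rw [hfun]
  have i1 := hS.integrable_drift_sq.const_mul ((j * h) ^ 2)
  have i2 : Integrable ((2 * (j * h)) • (θ * fun ω ↦ avgInc j s n (Z · ω))) P :=
    (hS.integrable_drift_mul_avgInc j s n).smul (2 * (j * h))
  filter_upwards [condExp_add (i1.add i2) ((hS.noise.memLp_avgSq j s n).integrable one_le_two)
      (MeasurableSpace.comap θ inferInstance),
    condExp_add i1 i2 (MeasurableSpace.comap θ inferInstance),
    condExp_smul (μ := P) (2 * (j * h)) (θ * fun ω ↦ avgInc j s n (Z · ω))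
      (MeasurableSpace.comap θ inferInstance), e2, e3] with ω h1 h2 h3 h4 h5
  rw [h1, Pi.add_apply, h2, Pi.add_apply, h3, Pi.smul_apply, h4, h5, e1]
  simp

lemma covariance_drift_mul_sq (hS : IsSubject P V θ Z) {g : (ℕ → ℝ) → ℝ} (hg : Measurable g)
    (hg2 : MemLp (fun ω ↦ g (Z · ω)) 2 P) (hg0 : ∫ ω, g (Z · ω) ∂P = 0) :
    cov[fun ω ↦ θ ω * g (Z · ω), fun ω ↦ θ ω ^ 2; P] = 0 := by
  have := hS.noise.isProbabilityMeasure
  rw [covariance_eq_sub (hS.memLp_drift_mul hg hg2) hS.memLp_drift_sq]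
  have h1 : P[(fun ω ↦ θ ω * g (Z · ω)) * fun ω ↦ θ ω ^ 2] = 0 := by
    have := hS.integral_comp_mul (f := fun x ↦ x ^ 3) (by fun_prop) hg
    rw [hg0, mul_zero] at this
    rw [← this]
    refine integral_congr_ae (Eventually.of_forall fun ω ↦ ?_)
    simp only [Pi.mul_apply]
    ring
  have h2 : ∫ ω, θ ω * g (Z · ω) ∂P = 0 := by
    rw [hS.integral_comp_mul (f := fun x ↦ x) measurable_id hg, hg0, mul_zero]
  rw [h1, h2]
  simp

lemma covariance_noise_sq (hS : IsSubject P V θ Z) {g : (ℕ → ℝ) → ℝ} (hg : Measurable g)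
    (hg2 : MemLp (fun ω ↦ g (Z · ω)) 2 P) :
    cov[fun ω ↦ g (Z · ω), fun ω ↦ θ ω ^ 2; P] = 0 :=
  (hS.indepFun_comp (f := fun x ↦ x ^ 2) (by fun_prop) hg).symm.covariance_eq_zero hg2
    hS.memLp_drift_sq

lemma covariance_avgSq_driftPath (hS : IsSubject P V θ Z) {n : ℕ} (hn : 0 < n) (j s : ℕ) (h : ℝ) :
    cov[fun ω ↦ avgSq j s n (driftPath h θ Z ω), fun ω ↦ θ ω ^ 2; P] =
      (j * h) ^ 2 * Var[fun ω ↦ θ ω ^ 2; P] := by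
  have := hS.noise.isProbabilityMeasure
  have hfun : (fun ω ↦ avgSq j s n (driftPath h θ Z ω)) = (fun ω ↦ (j * h) ^ 2 * θ ω ^ 2) +
      (fun ω ↦ 2 * (j * h) * (θ ω * avgInc j s n (Z · ω))) + fun ω ↦ avgSq j s n (Z · ω) := by
    ext ω; simp [avgSq_driftPath hn]
  have m1 := hS.memLp_drift_sq.const_mul ((j * h) ^ 2)
  have m2 := (hS.memLp_drift_mul (measurable_avgInc j s n)
    (hS.noise.memLp_avgInc j s n)).const_mul (2 * (j * h))
  rw [hfun, covariance_add_left (m1.add m2) (hS.noise.memLp_avgSq j s n) hS.memLp_drift_sq,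
    covariance_add_left m1 m2 hS.memLp_drift_sq, covariance_const_mul_left,
    covariance_const_mul_left, hS.covariance_drift_mul_sq (measurable_avgInc j s n)
      (hS.noise.memLp_avgInc j s n) (hS.noise.integral_avgInc j s n),
    hS.covariance_noise_sq (measurable_avgSq j s n) (hS.noise.memLp_avgSq j s n),
    covariance_self hS.memLp_drift_sq.aemeasurable]
  ring

/-! ### The squared drift estimator of one subject -/

lemma integral_noise_div_sq (hS : IsSubject P V θ Z) (n : ℕ) (c : ℝ) :
    ∫ ω, ((Z n ω - Z 0 ω) / c) ^ 2 ∂P = V n / c ^ 2 := by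
  simp only [div_pow]
  rw [integral_div, hS.noise.variogram]
  simp

lemma integrable_noise_div_pow (hS : IsSubject P V θ Z) (n p : ℕ) (c : ℝ) :
    Integrable (fun ω ↦ ((Z n ω - Z 0 ω) / c) ^ p) P := by
  simp only [div_pow]
  exact ((hS.noise.hasGaussianLaw_sub n 0).integrable_pow p).div_const _

lemma memLp_noise_div_sq (hS : IsSubject P V θ Z) (n : ℕ) (c : ℝ) :
    MemLp (fun ω ↦ ((Z n ω - Z 0 ω) / c) ^ 2) 2 P := by
  simp only [div_eq_mul_inv, mul_pow]
  exact (memLp_two_sq_of_hasGaussianLaw (hS.noise.hasGaussianLaw_sub n 0)).mul_const _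

lemma memLp_noise_div (hS : IsSubject P V θ Z) (n : ℕ) (c : ℝ) :
    MemLp (fun ω ↦ (Z n ω - Z 0 ω) / c) 2 P := by
  simp only [div_eq_mul_inv]
  exact (hS.noise.memLp_sub n 0).mul_const _

lemma integral_noise_div (hS : IsSubject P V θ Z) (n : ℕ) (c : ℝ) :
    ∫ ω, (Z n ω - Z 0 ω) / c ∂P = 0 := by
  rw [integral_div, hS.noise.centred, zero_div]

lemma integral_sq_drift_add_noise (hS : IsSubject P V θ Z) (n : ℕ) (c : ℝ) :
    ∫ ω, (θ ω + (Z n ω - Z 0 ω) / c) ^ 2 ∂P = ∫ ω, θ ω ^ 2 ∂P + V n / c ^ 2 := by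
  have hA := hS.memLp_noise_div n c
  have hcross : ∫ ω, θ ω * ((Z n ω - Z 0 ω) / c) ∂P = 0 := by
    rw [hS.integral_comp_mul (f := fun x ↦ x) (g := fun z ↦ (z n - z 0) / c) measurable_id
      (by fun_prop), hS.integral_noise_div, mul_zero]
  have i2 : Integrable (fun ω ↦ 2 * (θ ω * ((Z n ω - Z 0 ω) / c))) P :=
    (hS.memLp_drift.integrable_mul hA).const_mul 2
  calc ∫ ω, (θ ω + (Z n ω - Z 0 ω) / c) ^ 2 ∂P
      = ∫ ω, (θ ω ^ 2 + 2 * (θ ω * ((Z n ω - Z 0 ω) / c)) + ((Z n ω - Z 0 ω) / c) ^ 2) ∂P := by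
        congr with ω; ring
    _ = _ := by
        rw [integral_add (hS.integrable_drift_sq.fun_add i2) (hS.integrable_noise_div_pow n 2 c),
          integral_add hS.integrable_drift_sq i2, integral_const_mul, hcross,
          hS.integral_noise_div_sq]
        ring

lemma memLp_sq_drift_add_noise (hS : IsSubject P V θ Z) (n : ℕ) (c : ℝ) :
    MemLp (fun ω ↦ (θ ω + (Z n ω - Z 0 ω) / c) ^ 2) 2 P := by
  have : (fun ω ↦ (θ ω + (Z n ω - Z 0 ω) / c) ^ 2) = (fun ω ↦ θ ω ^ 2) +
      ((fun ω ↦ 2 * (θ ω * ((Z n ω - Z 0 ω) / c))) + fun ω ↦ ((Z n ω - Z 0 ω) / c) ^ 2) := by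
    ext ω; simp only [Pi.add_apply]; ring
  rw [this]
  exact hS.memLp_drift_sq.add (((hS.memLp_drift_mul (g := fun z ↦ (z n - z 0) / c) (by fun_prop)
    (hS.memLp_noise_div n c)).const_mul 2).add (hS.memLp_noise_div_sq n c))

lemma abs_variance_sq_drift_add_noise_sub_le (hS : IsSubject P V θ Z) (n : ℕ) (c : ℝ) :
    |Var[fun ω ↦ (θ ω + (Z n ω - Z 0 ω) / c) ^ 2; P] - Var[fun ω ↦ θ ω ^ 2; P]| ≤
      8 * (∫ ω, θ ω ^ 2 ∂P) * (V n / c ^ 2) + 6 * (V n / c ^ 2) ^ 2 := by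
  have := hS.noise.isProbabilityMeasure
  set A : Ω → ℝ := fun ω ↦ (Z n ω - Z 0 ω) / c with hA
  have hg : Measurable fun z : ℕ → ℝ ↦ (z n - z 0) / c := by fun_prop
  have m1 : MemLp (fun ω ↦ 2 * (θ ω * A ω)) 2 P :=
    (hS.memLp_drift_mul hg (hS.memLp_noise_div n c)).const_mul 2
  have m2 : MemLp (fun ω ↦ A ω ^ 2) 2 P := hS.memLp_noise_div_sq n c
  have hfun : (fun ω ↦ (θ ω + A ω) ^ 2) = (fun ω ↦ θ ω ^ 2) +
      ((fun ω ↦ 2 * (θ ω * A ω)) + fun ω ↦ A ω ^ 2) := by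
    ext ω; simp only [Pi.add_apply]; ring
  have hcov : cov[fun ω ↦ θ ω ^ 2, (fun ω ↦ 2 * (θ ω * A ω)) + fun ω ↦ A ω ^ 2; P] = 0 := by
    rw [covariance_comm, covariance_add_left m1 m2 hS.memLp_drift_sq, covariance_const_mul_left,
      hS.covariance_drift_mul_sq hg (hS.memLp_noise_div n c) (hS.integral_noise_div n c),
      hS.covariance_noise_sq (g := fun z ↦ ((z n - z 0) / c) ^ 2) (by fun_prop) m2]
    simp
  have hvar : Var[fun ω ↦ (θ ω + A ω) ^ 2; P] = Var[fun ω ↦ θ ω ^ 2; P] +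
      Var[(fun ω ↦ 2 * (θ ω * A ω)) + fun ω ↦ A ω ^ 2; P] := by
    rw [hfun, variance_add hS.memLp_drift_sq (m1.add m2), hcov]
    ring
  have h4 : ∫ ω, A ω ^ 4 ∂P = 3 * (V n / c ^ 2) ^ 2 := by
    simp only [hA, div_pow]
    rw [integral_div, integral_pow_four_of_hasGaussianLaw (hS.noise.hasGaussianLaw_sub n 0)
      (hS.noise.centred n 0), hS.noise.variogram]
    simp only [Nat.cast_zero, sub_zero]
    ring
  have h22 : ∫ ω, θ ω ^ 2 * A ω ^ 2 ∂P = (∫ ω, θ ω ^ 2 ∂P) * (V n / c ^ 2) := by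
    rw [hS.integral_comp_mul (f := fun x ↦ x ^ 2) (g := fun z ↦ ((z n - z 0) / c) ^ 2)
      (by fun_prop) (by fun_prop), hS.integral_noise_div_sq]
  have i22 : Integrable (fun ω ↦ θ ω ^ 2 * A ω ^ 2) P :=
    hS.memLp_drift_sq.integrable_mul m2
  have i4 : Integrable (fun ω ↦ A ω ^ 4) P := hS.integrable_noise_div_pow n 4 c
  rw [hvar, add_sub_cancel_left, abs_of_nonneg (variance_nonneg _ _)]
  calc Var[(fun ω ↦ 2 * (θ ω * A ω)) + fun ω ↦ A ω ^ 2; P]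
      ≤ ∫ ω, ((fun ω ↦ 2 * (θ ω * A ω)) + fun ω ↦ A ω ^ 2) ω ^ 2 ∂P :=
        variance_le_expectation_sq (m1.add m2).aestronglyMeasurable
    _ ≤ ∫ ω, (8 * (θ ω ^ 2 * A ω ^ 2) + 2 * A ω ^ 4) ∂P := by
        refine integral_mono (m1.add m2).integrable_sq
          ((i22.const_mul 8).add (i4.const_mul 2)) fun ω ↦ ?_
        simp only [Pi.add_apply]
        nlinarith [sq_nonneg (2 * (θ ω * A ω) - A ω ^ 2)]
    _ = _ := by
        rw [integral_add (i22.const_mul 8) (i4.const_mul 2), integral_const_mul,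
          integral_const_mul, h4, h22]
        ring

end IsSubject

end OneSubject

/-! ### Convergence in mean of averages over subjects -/

section L1Convergence

section ScaledMean

variable {Ω : Type*}

/-- `√N` times the average over the first `N` subjects. -/
noncomputable def scaledMean (N : ℕ) (F : ℕ → Ω → ℝ) (ω : Ω) : ℝ :=
  √(N : ℝ) * ((1 / N) * ∑ i ∈ Finset.range N, F i ω)

lemma scaledMean_add (N : ℕ) (F G : ℕ → Ω → ℝ) (ω : Ω) :
    scaledMean N (fun i ω ↦ F i ω + G i ω) ω = scaledMean N F ω + scaledMean N G ω := by
  simp only [scaledMean, Finset.sum_add_distrib]; ring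

lemma scaledMean_const_mul (N : ℕ) (c : ℝ) (F : ℕ → Ω → ℝ) (ω : Ω) :
    scaledMean N (fun i ω ↦ c * F i ω) ω = c * scaledMean N F ω := by
  simp only [scaledMean, ← Finset.mul_sum]; ring

end ScaledMean

variable {Ω : Type*} [MeasurableSpace Ω] {P : Measure Ω}

lemma integrable_scaledMean {F : ℕ → Ω → ℝ} (hF : ∀ i, Integrable (F i) P) (N : ℕ) :
    Integrable (scaledMean N F) P :=
  ((integrable_finsetSum _ fun i _ ↦ hF i).const_mul _).const_mul _

lemma integral_abs_scaledMean_le {F : ℕ → Ω → ℝ} (hF : ∀ i, Integrable (F i) P) {w : ℝ}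
    (hw : ∀ i, ∫ ω, |F i ω| ∂P ≤ w) (N : ℕ) : ∫ ω, |scaledMean N F ω| ∂P ≤ √(N : ℝ) * w := by
  rcases Nat.eq_zero_or_pos N with rfl | hN
  · simp [scaledMean]
  have hN' : (0 : ℝ) < N := by exact_mod_cast hN
  calc ∫ ω, |scaledMean N F ω| ∂P
      ≤ ∫ ω, √(N : ℝ) * ((1 / N) * ∑ i ∈ Finset.range N, |F i ω|) ∂P := by
        refine integral_mono (integrable_scaledMean hF N).abs
          (((integrable_finsetSum _ fun i _ ↦ (hF i).abs).const_mul _).const_mul _) fun ω ↦ ?_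
        dsimp only [scaledMean]
        rw [abs_mul, abs_mul, abs_of_nonneg (Real.sqrt_nonneg _),
          abs_of_nonneg (by positivity : (0 : ℝ) ≤ 1 / N)]
        gcongr
        exact Finset.abs_sum_le_sum_abs _ _
    _ = √(N : ℝ) * ((1 / N) * ∑ i ∈ Finset.range N, ∫ ω, |F i ω| ∂P) := by
        rw [integral_const_mul, integral_const_mul, integral_finsetSum _ fun i _ ↦ (hF i).abs]
    _ ≤ √(N : ℝ) * ((1 / N) * ∑ i ∈ Finset.range N, w) := by
        gcongr with i
        exact hw i
    _ = √(N : ℝ) * w := by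
        simp only [Finset.sum_const, Finset.card_range, nsmul_eq_mul]
        field_simp

lemma integral_abs_scaledMean_le_sqrt [IsProbabilityMeasure P] {F : ℕ → Ω → ℝ}
    (hF : ∀ i, MemLp (F i) 2 P) (h0 : ∀ i, ∫ ω, F i ω ∂P = 0) {v : ℝ}
    (hv : ∀ i, Var[F i; P] = v) (hind : Pairwise fun i j ↦ IndepFun (F i) (F j) P) (N : ℕ) :
    ∫ ω, |scaledMean N F ω| ∂P ≤ √v := by
  rcases Nat.eq_zero_or_pos N with rfl | hN
  · simp [scaledMean]
  have hN' : (0 : ℝ) < N := by exact_mod_cast hN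
  have hi : ∀ i, Integrable (F i) P := fun i ↦ (hF i).integrable one_le_two
  have hsum : MemLp (∑ i ∈ Finset.range N, F i) 2 P := memLp_finsetSum' _ fun i _ ↦ hF i
  have hfun : scaledMean N F = fun ω ↦ (√(N : ℝ) * (1 / N)) * (∑ i ∈ Finset.range N, F i) ω := by
    ext ω; simp [scaledMean, mul_assoc]
  have hL2 : MemLp (scaledMean N F) 2 P := hfun ▸ hsum.const_mul _
  have hmean : ∫ ω, scaledMean N F ω ∂P = 0 := by
    simp only [scaledMean]
    rw [integral_const_mul, integral_const_mul, integral_finsetSum _ fun i _ ↦ hi i]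
    simp [h0]
  have hvar : ∫ ω, scaledMean N F ω ^ 2 ∂P = v := by
    have h1 : Var[scaledMean N F; P] = ∫ ω, scaledMean N F ω ^ 2 ∂P := by
      simp [variance_eq_integral hL2.aemeasurable, hmean]
    rw [← h1, hfun, variance_const_mul, IndepFun.variance_sum (fun i _ ↦ hF i)
      (fun i _ j _ hij ↦ hind hij)]
    simp only [hv, Finset.sum_const, Finset.card_range, nsmul_eq_mul, mul_pow,
      Real.sq_sqrt hN'.le]
    field_simp
  refine Real.le_sqrt_of_sq_le ?_
  have h2 := variance_eq_sub hL2.norm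
  have h3 := variance_nonneg (fun ω ↦ ‖scaledMean N F ω‖) P
  simp only [Pi.pow_apply, Real.norm_eq_abs, sq_abs, hvar] at h2 h3
  linarith

/-- Convergence to zero in `L¹`, with integrability from some index on. -/
def TendstoL1Zero (P : Measure Ω) (F : ℕ → Ω → ℝ) : Prop :=
  (∀ᶠ m in atTop, Integrable (F m) P) ∧ Tendsto (fun m ↦ ∫ ω, |F m ω| ∂P) atTop (𝓝 0)

namespace TendstoL1Zero

variable {F G : ℕ → Ω → ℝ}

lemma add (hF : TendstoL1Zero P F) (hG : TendstoL1Zero P G) :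
    TendstoL1Zero P fun m ω ↦ F m ω + G m ω := by
  refine ⟨(hF.1.and hG.1).mono fun m hm ↦ hm.1.add hm.2, ?_⟩
  refine squeeze_zero' (Eventually.of_forall fun m ↦ by positivity) ?_
    (by simpa using hF.2.add hG.2)
  filter_upwards [hF.1, hG.1] with m h1 h2
  rw [← integral_add h1.abs h2.abs]
  exact integral_mono (h1.add h2).abs (h1.abs.add h2.abs) fun ω ↦ abs_add_le _ _

lemma const_mul (hF : TendstoL1Zero P F) (c : ℝ) : TendstoL1Zero P fun m ω ↦ c * F m ω := by
  refine ⟨hF.1.mono fun m hm ↦ hm.const_mul c, ?_⟩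
  simpa [abs_mul, integral_const_mul] using hF.2.const_mul |c|

lemma congr' (hF : TendstoL1Zero P F) (h : ∀ᶠ m in atTop, F m = G m) : TendstoL1Zero P G := by
  refine ⟨?_, hF.2.congr' (h.mono fun m hm ↦ by rw [hm])⟩
  filter_upwards [hF.1, h] with m h1 h2
  rwa [← h2]

lemma zero : TendstoL1Zero P fun _ _ ↦ 0 :=
  ⟨Eventually.of_forall fun _ ↦ integrable_zero _ _ _, by simp⟩

lemma finset_sum {ι : Type*} (s : Finset ι) {F : ι → ℕ → Ω → ℝ}
    (hF : ∀ i ∈ s, TendstoL1Zero P (F i)) : TendstoL1Zero P fun m ω ↦ ∑ i ∈ s, F i m ω := by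
  classical
  induction s using Finset.induction_on with
  | empty => simpa using zero
  | insert i s his ih =>
    simp only [Finset.sum_insert his]
    exact (hF i (Finset.mem_insert_self i s)).add
      (ih fun j hj ↦ hF j (Finset.mem_insert_of_mem hj))

end TendstoL1Zero

section Regime

variable {n N : ℕ → ℕ}

lemma eventually_le_of_tendsto_div (hN : Tendsto N atTop atTop)
    (hnN : Tendsto (fun m ↦ (n m : ℝ) / (N m : ℝ)) atTop atTop) : ∀ᶠ m in atTop, N m ≤ n m := by
  filter_upwards [hnN.eventually_ge_atTop 1, hN.eventually_gt_atTop 0] with m h1 h2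
  have h2' : (0 : ℝ) < N m := by exact_mod_cast h2
  have := (one_le_div h2').1 h1
  exact_mod_cast this

lemma tendsto_atTop_of_tendsto_div (hN : Tendsto N atTop atTop)
    (hnN : Tendsto (fun m ↦ (n m : ℝ) / (N m : ℝ)) atTop atTop) : Tendsto n atTop atTop :=
  tendsto_atTop_mono' _ (eventually_le_of_tendsto_div hN hnN) hN

/-- As `N ≤ n` eventually, a factor `√N` is absorbed by anything that is `o(n ^ (-1/2))`. -/
lemma tendsto_sqrt_mul_of_tendsto_div (hN : Tendsto N atTop atTop)
    (hnN : Tendsto (fun m ↦ (n m : ℝ) / (N m : ℝ)) atTop atTop) {u : ℕ → ℝ} (hu0 : ∀ n, 0 ≤ u n)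
    (hu : Tendsto (fun n : ℕ ↦ √(n : ℝ) * u n) atTop (𝓝 0)) :
    Tendsto (fun m ↦ √(N m : ℝ) * u (n m)) atTop (𝓝 0) := by
  refine squeeze_zero' (Eventually.of_forall fun m ↦ mul_nonneg (Real.sqrt_nonneg _) (hu0 _)) ?_
    (hu.comp (tendsto_atTop_of_tendsto_div hN hnN))
  filter_upwards [eventually_le_of_tendsto_div hN hnN] with m hm
  have : (N m : ℝ) ≤ n m := by exact_mod_cast hm
  exact mul_le_mul_of_nonneg_right (Real.sqrt_le_sqrt this) (hu0 _)

lemma tendsto_sqrt_mul_const_div (c : ℝ) :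
    Tendsto (fun n : ℕ ↦ √(n : ℝ) * (1 / n * c)) atTop (𝓝 0) := by
  have h1 := (tendsto_rpow_neg_atTop (y := 1 / 2) (by norm_num)).comp
    (tendsto_natCast_atTop_atTop (R := ℝ))
  have h2 := h1.mul_const c
  rw [zero_mul] at h2
  refine h2.congr' ?_
  filter_upwards [eventually_gt_atTop 0] with n hn
  have hn' : (0 : ℝ) < n := by exact_mod_cast hn
  simp only [Function.comp_apply]
  rw [Real.rpow_neg hn'.le, ← Real.sqrt_eq_rpow, ← mul_assoc, mul_one_div, Real.sqrt_div_self']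
  simp

end Regime

section Family

variable {V : ℤ → ℝ} {θ : ℕ → Ω → ℝ} {Z : ℕ → ℕ → Ω → ℝ} {n N : ℕ → ℕ}

/-- The drifts of the subjects cancel up to boundary terms, of size `√N / n` after scaling. -/
lemma tendstoL1Zero_boundary (hS : ∀ i, IsSubject P V (θ i) (Z i)) {m₂ : ℝ}
    (hm₂ : ∀ i, ∫ ω, θ i ω ^ 2 ∂P = m₂) (hN : Tendsto N atTop atTop)
    (hnN : Tendsto (fun m ↦ (n m : ℝ) / (N m : ℝ)) atTop atTop) (j s : ℕ) :
    TendstoL1Zero P fun m ↦ scaledMean (N m) fun i ω ↦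
      θ i ω * (avgInc j s (n m) (Z i · ω) - j * ((Z i (n m) ω - Z i 0 ω) / n m)) := by
  have := (hS 0).noise.isProbabilityMeasure
  set C : ℝ := ∑ i ∈ Finset.range j, 2 * (1 + V (s + i : ℕ)) with hC
  have hC0 : 0 ≤ C := Finset.sum_nonneg fun i _ ↦ by
    have := (hS 0).noise.variogram_nonneg (s + i)
    positivity
  have hm₂0 : 0 ≤ m₂ := by rw [← hm₂ 0]; positivity
  have hmeas : ∀ n : ℕ, Measurable fun z : ℕ → ℝ ↦ avgInc j s n z - j * ((z n - z 0) / n) :=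
    fun n ↦ by fun_prop
  have hint : ∀ i n, Integrable
      (fun ω ↦ avgInc j s n (Z i · ω) - j * ((Z i n ω - Z i 0 ω) / n)) P := fun i n ↦
    (((hS i).noise.memLp_avgInc j s n).integrable one_le_two).sub
      ((((hS i).noise.integrable_sub n 0).div_const _).const_mul _)
  have hFint : ∀ n i, Integrable
      (fun ω ↦ θ i ω * (avgInc j s n (Z i · ω) - j * ((Z i n ω - Z i 0 ω) / n))) P := fun n i ↦
    ((hS i).indepFun_comp measurable_id (hmeas n)).integrable_mul
      ((hS i).memLp_drift.integrable one_le_two) (hint i n)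
  have hbound : ∀ n i, ∫ ω, |θ i ω * (avgInc j s n (Z i · ω) -
      j * ((Z i n ω - Z i 0 ω) / n))| ∂P ≤ 1 / n * ((1 + m₂) * C) := by
    intro n i
    simp only [abs_mul]
    rw [(hS i).integral_comp_mul (f := fun x ↦ |x|)
      (g := fun z ↦ |avgInc j s n z - j * ((z n - z 0) / n)|) (by fun_prop)
      (measurable_norm.comp (hmeas n))]
    -- The bound `|x| ≤ 1 + x²` makes it uniform in the subject.
    have h1 : ∫ ω, |θ i ω| ∂P ≤ 1 + m₂ := by
      calc ∫ ω, |θ i ω| ∂P ≤ ∫ ω, (1 + θ i ω ^ 2) ∂P := by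
            refine integral_mono ((hS i).memLp_drift.integrable one_le_two).abs
              ((integrable_const 1).add (hS i).integrable_drift_sq) fun ω ↦ ?_
            nlinarith [sq_nonneg (|θ i ω| - 1), sq_abs (θ i ω), abs_nonneg (θ i ω)]
        _ = 1 + m₂ := by
            rw [integral_add (integrable_const 1) (hS i).integrable_drift_sq, hm₂ i]
            simp
    calc _ ≤ (1 + m₂) * ((1 / n) * C) := by
          refine mul_le_mul h1 ((hS i).noise.integral_abs_avgInc_sub_le j s n) ?_ (by positivity)
          positivity
      _ = _ := by ring
  refine ⟨Eventually.of_forall fun m ↦ integrable_scaledMean (hFint (n m)) (N m), ?_⟩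
  refine squeeze_zero (fun m ↦ by positivity)
    (fun m ↦ integral_abs_scaledMean_le (hFint (n m)) (hbound (n m)) (N m)) ?_
  exact tendsto_sqrt_mul_of_tendsto_div hN hnN (u := fun n ↦ 1 / n * ((1 + m₂) * C))
    (fun n ↦ by positivity) (tendsto_sqrt_mul_const_div _)

/-- The fluctuations of the averaged quadratic variations: by independence across subjects, their
size is the standard deviation within one subject, which vanishes as `n → ∞`. -/
lemma tendstoL1Zero_avgSq (hS : ∀ i, IsSubject P V (θ i) (Z i))
    (hind : iIndepFun (fun i ω k ↦ Z i k ω) P) (hn : Tendsto n atTop atTop) (j s : ℕ)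
    (hV : Tendsto (fun d : ℕ ↦ incrCov V j d) atTop (𝓝 0)) :
    TendstoL1Zero P fun m ↦ scaledMean (N m) fun i ω ↦ avgSq j s (n m) (Z i · ω) - V j := by
  have := (hS 0).noise.isProbabilityMeasure
  have hL2 : ∀ n i, MemLp (fun ω ↦ avgSq j s n (Z i · ω) - V j) 2 P := fun n i ↦
    ((hS i).noise.memLp_avgSq j s n).sub (memLp_const _)
  refine ⟨Eventually.of_forall fun m ↦
    integrable_scaledMean (fun i ↦ (hL2 (n m) i).integrable one_le_two) (N m), ?_⟩
  have hlim : Tendsto (fun m ↦ √(avgSqVar V j (n m))) atTop (𝓝 0) := by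
    have := ((tendsto_avgSqVar (hS 0).noise.even j hV).comp hn).sqrt
    simpa using this
  refine squeeze_zero' (Eventually.of_forall fun m ↦ by positivity) ?_ hlim
  filter_upwards [hn.eventually_gt_atTop 0] with m hm
  refine integral_abs_scaledMean_le_sqrt (hL2 (n m)) (fun i ↦ ?_) (fun i ↦ ?_)
    (fun i i' hii' ↦ ?_) (N m)
  · rw [integral_sub (((hS i).noise.memLp_avgSq j s _).integrable one_le_two)
      (integrable_const _), (hS i).noise.integral_avgSq j s hm]
    simp
  · rw [variance_sub_const ((hS i).noise.memLp_avgSq j s _).aestronglyMeasurable,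
      (hS i).noise.variance_avgSq]
  · exact (hind.indepFun hii').comp (φ := fun z ↦ avgSq j s (n m) z - V j)
      (ψ := fun z ↦ avgSq j s (n m) z - V j) (by fun_prop) (by fun_prop)

/-- The bias of the squared drift estimators. -/
lemma tendstoL1Zero_noise_sq (hS : ∀ i, IsSubject P V (θ i) (Z i)) (hN : Tendsto N atTop atTop)
    (hnN : Tendsto (fun m ↦ (n m : ℝ) / (N m : ℝ)) atTop atTop)
    (hV : Tendsto (fun n : ℕ ↦ √(n : ℝ) * (V n / (n : ℝ) ^ 2)) atTop (𝓝 0)) :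
    TendstoL1Zero P fun m ↦ scaledMean (N m) fun i ω ↦
      ((Z i (n m) ω - Z i 0 ω) / n m) ^ 2 := by
  have hF : ∀ m i, Integrable (fun ω ↦ ((Z i (n m) ω - Z i 0 ω) / n m) ^ 2) P := fun m i ↦
    (hS i).integrable_noise_div_pow _ _ _
  refine ⟨Eventually.of_forall fun m ↦ integrable_scaledMean (hF m) (N m), ?_⟩
  refine squeeze_zero (fun m ↦ by positivity)
    (fun m ↦ integral_abs_scaledMean_le (hF m) (w := V (n m) / (n m : ℝ) ^ 2) (fun i ↦ ?_) (N m)) ?_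
  · simp only [abs_sq]
    rw [(hS i).integral_noise_div_sq]
  · exact tendsto_sqrt_mul_of_tendsto_div hN hnN (u := fun n ↦ V n / (n : ℝ) ^ 2)
      (fun n ↦ div_nonneg ((hS 0).noise.variogram_nonneg n) (by positivity)) hV

/-- Correcting the averaged quadratic variations by the squared drift estimators removes the drifts
up to `o(N ^ (-1/2))`. -/
lemma tendstoL1Zero_residual (hS : ∀ i, IsSubject P V (θ i) (Z i))
    (hind : iIndepFun (fun i ω k ↦ Z i k ω) P) {m₂ : ℝ} (hm₂ : ∀ i, ∫ ω, θ i ω ^ 2 ∂P = m₂)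
    (hN : Tendsto N atTop atTop) (hnN : Tendsto (fun m ↦ (n m : ℝ) / (N m : ℝ)) atTop atTop)
    {h : ℝ} (hh : h ≠ 0) (j s : ℕ)
    (hV : Tendsto (fun d : ℕ ↦ incrCov V j d) atTop (𝓝 0))
    (hV' : Tendsto (fun n : ℕ ↦ √(n : ℝ) * (V n / (n : ℝ) ^ 2)) atTop (𝓝 0)) :
    TendstoL1Zero P fun m ↦ scaledMean (N m) fun i ω ↦
      avgSq j s (n m) (driftPath h (θ i) (Z i) ω) -
        (j * h) ^ 2 * (θ i ω + (Z i (n m) ω - Z i 0 ω) / (n m * h)) ^ 2 - V j := by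
  have hn := tendsto_atTop_of_tendsto_div hN hnN
  have h1 := (tendstoL1Zero_boundary hS hm₂ hN hnN j s).const_mul (2 * (j * h))
  have h2 := tendstoL1Zero_avgSq (N := N) hS hind hn j s hV
  have h3 := (tendstoL1Zero_noise_sq hS hN hnN hV').const_mul (-(j : ℝ) ^ 2)
  refine ((h1.add h2).add h3).congr' ?_
  filter_upwards [hn.eventually_gt_atTop 0] with m hm
  ext ω
  rw [← scaledMean_const_mul, ← scaledMean_const_mul, ← scaledMean_add, ← scaledMean_add]
  congr 1
  ext i ω
  have hm' : (n m : ℝ) ≠ 0 := by exact_mod_cast hm.ne'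
  rw [avgSq_driftPath hm]
  field_simp
  ring

end Family

end L1Convergence

/-! ### The mixed process on the sampling grid -/

section MixedProcess

variable {Ω : Type*} [MeasurableSpace Ω] {P : Measure Ω}

lemma hasGaussianLaw_sub_prodMk_sub {T : Type*} {X : T → Ω → ℝ} (hX : IsGaussianProcess X P)
    (s t u v : T) : HasGaussianLaw (fun ω ↦ (X s ω - X t ω, X u ω - X v ω)) P := by
  classical
  let I : Finset T := {s, t, u, v}
  let e : ∀ r ∈ I, (I → ℝ) →L[ℝ] ℝ := fun r hr ↦ ContinuousLinearMap.proj ⟨r, hr⟩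
  let L : (I → ℝ) →L[ℝ] ℝ × ℝ :=
    (e s (by simp [I]) - e t (by simp [I])).prod (e u (by simp [I]) - e v (by simp [I]))
  exact (hX.hasGaussianLaw I).map_fun L

lemma integral_sub_sq_of_covariance {T : Type*} {X : T → Ω → ℝ} (hX : IsGaussianProcess X P)
    (h0 : ∀ t, ∫ ω, X t ω ∂P = 0) {K : T → T → ℝ} (hK : ∀ s t, cov[X s, X t; P] = K s t)
    (s t : T) : ∫ ω, (X s ω - X t ω) ^ 2 ∂P = K s s + K t t - 2 * K s t := by
  have := hX.isProbabilityMeasure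
  have hL := fun r ↦ (hX.hasGaussianLaw_eval r).memLp_two
  have hi : ∀ r q, Integrable (fun ω ↦ X r ω * X q ω) P := fun r q ↦ (hL r).integrable_mul (hL q)
  have hK' : ∀ r q, ∫ ω, X r ω * X q ω ∂P = K r q := by
    intro r q
    rw [← hK, covariance_eq_sub (hL r) (hL q), h0, h0]
    simp
  calc ∫ ω, (X s ω - X t ω) ^ 2 ∂P
      = ∫ ω, (X s ω * X s ω + X t ω * X t ω - 2 * (X s ω * X t ω)) ∂P := by
        congr with ω; ring
    _ = _ := by
        rw [integral_sub ((hi _ _).fun_add (hi _ _)) ((hi _ _).const_mul 2),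
          integral_add (hi _ _) (hi _ _), integral_const_mul, hK', hK', hK']

lemma isGaussianNoise_mixed {H σ γ : ℝ} (hH : 0 < H) {B BH : ℝ≥0 → Ω → ℝ}
    (hBm : ∀ t, Measurable (B t)) (hBHm : ∀ t, Measurable (BH t)) (hB : IsBrownianReal B P)
    (hBH : IsFractionalBrownian H BH P)
    (hind : IndepFun (fun ω t ↦ B t ω) (fun ω t ↦ BH t ω) P) (h : ℝ≥0) :
    IsGaussianNoise P (mixedVariogram (σ ^ 2 * h) (γ ^ 2 * (h : ℝ) ^ (2 * H)) (2 * H))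
      (fun k ↦ mixed σ γ B BH ((k : ℝ≥0) * h)) where
  measurable k := ((hBm _).const_mul σ).add ((hBHm _).const_mul γ)
  hasGaussianLaw k l a b := by
    have h1 := hasGaussianLaw_sub_prodMk_sub hB.isGaussianProcess ((k : ℝ≥0) * h) ((l : ℝ≥0) * h)
      ((a : ℝ≥0) * h) ((b : ℝ≥0) * h)
    have h2 := hasGaussianLaw_sub_prodMk_sub hBH.gaussian ((k : ℝ≥0) * h) ((l : ℝ≥0) * h)
      ((a : ℝ≥0) * h) ((b : ℝ≥0) * h)
    let g : (ℝ≥0 → ℝ) → ℝ × ℝ := fun z ↦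
      (z ((k : ℝ≥0) * h) - z ((l : ℝ≥0) * h), z ((a : ℝ≥0) * h) - z ((b : ℝ≥0) * h))
    have hg : Measurable g := by fun_prop
    have h12 := IndepFun.hasGaussianLaw h1 h2 (hind.comp hg hg)
    let L : (ℝ × ℝ) × (ℝ × ℝ) →L[ℝ] ℝ × ℝ :=
      σ • ContinuousLinearMap.fst ℝ (ℝ × ℝ) (ℝ × ℝ) + γ • ContinuousLinearMap.snd ℝ (ℝ × ℝ) (ℝ × ℝ)
    refine (h12.map_fun L).congr (Eventually.of_forall fun ω ↦ ?_)
    simp only [L, mixed, _root_.add_apply, _root_.smul_apply,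
      ContinuousLinearMap.coe_fst', ContinuousLinearMap.coe_snd', Prod.smul_mk, Prod.mk_add_mk,
      smul_eq_mul, Prod.mk.injEq]
    constructor <;> ring
  centred k l := by
    have i1 := fun t ↦ (hB.integrable_eval t).const_mul σ
    have i2 := fun t ↦ (hBH.gaussian.hasGaussianLaw_eval t).integrable.const_mul γ
    have h0 : ∀ t, ∫ ω, mixed σ γ B BH t ω ∂P = 0 := by
      intro t
      unfold mixed
      rw [integral_add (i1 t) (i2 t), integral_const_mul, integral_const_mul, hB.integral_eval,
        hBH.centred]
      simp
    have hi : ∀ t, Integrable (mixed σ γ B BH t) P := fun t ↦ (i1 t).add (i2 t)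
    rw [integral_sub (hi _) (hi _), h0, h0, sub_zero]
  variogram k l := by
    set s : ℝ≥0 := (k : ℝ≥0) * h with hs
    set t : ℝ≥0 := (l : ℝ≥0) * h with ht
    have hdist : |(s : ℝ) - t| = |(k : ℝ) - l| * h := by
      rw [hs, ht]
      push_cast
      rw [← sub_mul, abs_mul, abs_of_nonneg h.coe_nonneg]
    have e1 : ∫ ω, (B s ω - B t ω) ^ 2 ∂P = |(k : ℝ) - l| * h := by
      rw [integral_sub_sq_of_covariance hB.isGaussianProcess hB.integral_eval hB.covariance_eval,
        ← hdist]
      rcases le_total s t with hst | hst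
      · have : (s : ℝ) ≤ t := by exact_mod_cast hst
        rw [min_eq_left hst, abs_of_nonpos (by linarith), min_self, min_self]; ring
      · have : (t : ℝ) ≤ s := by exact_mod_cast hst
        rw [min_eq_right hst, abs_of_nonneg (by linarith), min_self, min_self]; ring
    have e2 : ∫ ω, (BH s ω - BH t ω) ^ 2 ∂P = |(k : ℝ) - l| ^ (2 * H) * (h : ℝ) ^ (2 * H) := by
      rw [integral_sub_sq_of_covariance hBH.gaussian hBH.centred hBH.covariance_eq,
        ← Real.mul_rpow (abs_nonneg _) h.coe_nonneg, ← hdist]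
      simp only [sub_self, abs_zero]
      rw [Real.zero_rpow (by positivity)]
      ring
    have g1 := (hasGaussianLaw_sub_prodMk_sub hB.isGaussianProcess s t s t).fst
    have g2 := (hasGaussianLaw_sub_prodMk_sub hBH.gaussian s t s t).fst
    have hcross : ∫ ω, (B s ω - B t ω) * (BH s ω - BH t ω) ∂P = 0 := by
      have := hind.integral_fun_comp_mul_comp (f := fun z ↦ z s - z t) (g := fun z ↦ z s - z t)
        (measurable_pi_lambda _ hBm).aemeasurable (measurable_pi_lambda _ hBHm).aemeasurable
        (by fun_prop : Measurable fun z : ℝ≥0 → ℝ ↦ z s - z t).aestronglyMeasurable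
        (by fun_prop : Measurable fun z : ℝ≥0 → ℝ ↦ z s - z t).aestronglyMeasurable
      rw [this, integral_sub (hB.integrable_eval s) (hB.integrable_eval t), hB.integral_eval,
        hB.integral_eval]
      simp
    have i3 : Integrable (fun ω ↦ (B s ω - B t ω) * (BH s ω - BH t ω)) P :=
      g1.memLp_two.integrable_mul g2.memLp_two
    calc ∫ ω, (mixed σ γ B BH s ω - mixed σ γ B BH t ω) ^ 2 ∂P
        = ∫ ω, (σ ^ 2 * (B s ω - B t ω) ^ 2 + γ ^ 2 * (BH s ω - BH t ω) ^ 2 +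
            2 * σ * γ * ((B s ω - B t ω) * (BH s ω - BH t ω))) ∂P := by
          congr with ω; unfold mixed; ring
      _ = σ ^ 2 * (|(k : ℝ) - l| * h) + γ ^ 2 * (|(k : ℝ) - l| ^ (2 * H) * (h : ℝ) ^ (2 * H)) := by
          rw [integral_add (((g1.integrable_pow 2).const_mul _).fun_add
              ((g2.integrable_pow 2).const_mul _)) (i3.const_mul _),
            integral_add ((g1.integrable_pow 2).const_mul _) ((g2.integrable_pow 2).const_mul _),
            integral_const_mul, integral_const_mul, integral_const_mul, e1, e2, hcross]
          ring
      _ = _ := by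
          unfold mixedVariogram
          push_cast
          ring

lemma integrable_drift_pow_four [IsFiniteMeasure P] {φ : Ω → ℝ} (hφ : Measurable φ)
    (h4 : Integrable (fun ω ↦ φ ω ^ 4) P) (σ : ℝ) : Integrable (fun ω ↦ drift σ φ ω ^ 4) P := by
  have hdom : Integrable (fun ω ↦ 8 * φ ω ^ 4 + 8 * (σ ^ 2 / 2) ^ 4) P :=
    (h4.const_mul 8).add (integrable_const _)
  refine hdom.mono' ((hφ.sub_const _).pow_const 4).aestronglyMeasurable
    (Eventually.of_forall fun ω ↦ ?_)
  rw [Real.norm_of_nonneg (by positivity), drift]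
  nlinarith [sq_nonneg (φ ω + σ ^ 2 / 2), sq_nonneg (φ ω ^ 2 - (σ ^ 2 / 2) ^ 2),
    sq_nonneg (φ ω * (φ ω + σ ^ 2 / 2)), sq_nonneg ((σ ^ 2 / 2) * (φ ω + σ ^ 2 / 2)),
    sq_nonneg ((φ ω + σ ^ 2 / 2) ^ 2), sq_nonneg ((φ ω + σ ^ 2 / 2) * (φ ω - σ ^ 2 / 2))]

lemma Model.isSubject [IsProbabilityMeasure P] {H σ γ : ℝ} (hH : 0 < H)
    {B BH : ℕ → ℝ≥0 → Ω → ℝ} {φ : ℕ → Ω → ℝ} (hM : Model P H σ γ B BH φ) (h : ℝ≥0) {i : ℕ}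
    (h4 : Integrable (fun ω ↦ φ i ω ^ 4) P) :
    IsSubject P (mixedVariogram (σ ^ 2 * h) (γ ^ 2 * (h : ℝ) ^ (2 * H)) (2 * H))
      (drift σ (φ i)) (fun k ↦ mixed σ γ (B i) (BH i) ((k : ℝ≥0) * h)) where
  noise := isGaussianNoise_mixed hH (hM.measurable_B i) (hM.measurable_BH i) (hM.brownian i)
    (hM.fractional i) (hM.indep_B_BH i) h
  measurable_drift := (hM.measurable_φ i).sub_const _
  integrable_drift := integrable_drift_pow_four (hM.measurable_φ i) h4 σ
  indep := hM.indep_φ_mixed.comp (φ := fun x : ℕ → ℝ ↦ x i - σ ^ 2 / 2)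
    (ψ := fun (z : ℕ → ℝ≥0 → ℝ) (k : ℕ) ↦ z i ((k : ℝ≥0) * h)) (by fun_prop)
    (measurable_pi_lambda _ fun k ↦ by fun_prop)

lemma Model.iIndepFun_noise {H σ γ : ℝ} {B BH : ℕ → ℝ≥0 → Ω → ℝ} {φ : ℕ → Ω → ℝ}
    (hM : Model P H σ γ B BH φ) (h : ℝ≥0) :
    iIndepFun (fun i ω (k : ℕ) ↦ mixed σ γ (B i) (BH i) ((k : ℝ≥0) * h) ω) P :=
  hM.indep_mixed.comp (fun _ (z : ℝ≥0 → ℝ) (k : ℕ) ↦ z ((k : ℝ≥0) * h))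
    fun _ ↦ measurable_pi_lambda _ fun k ↦ by fun_prop

lemma Model.identDistrib_drift {H σ γ : ℝ} {B BH : ℕ → ℝ≥0 → Ω → ℝ} {φ : ℕ → Ω → ℝ}
    (hM : Model P H σ γ B BH φ) (i j : ℕ) :
    IdentDistrib (fun ω ↦ drift σ (φ i) ω ^ 2) (fun ω ↦ drift σ (φ j) ω ^ 2) P P :=
  (hM.identDistrib_φ i j).comp (u := fun x ↦ (x - σ ^ 2 / 2) ^ 2) (by fun_prop)

end MixedProcess

/-! ### The moment statistics as combinations of quadratic variations -/

section MomentStatistics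

/-- Weight of the `t`-th quadratic variation in the `a`-th moment statistic. The product
`(y_{k+j} - y_k) (y_{k+2j} - y_{k+j})` is polarized into the squares of its two factors and of their
sum, so that `ξ`, `η`, `ζ` become combinations of averaged squares. -/
noncomputable def polarWeight : Fin 3 → Fin 3 → ℝ :=
  ![![1, 0, 0], ![1 / 2, -1 / 2, -1 / 2], ![1 / 2, -1 / 2, -1 / 2]]

/-- Block length of the `t`-th quadratic variation in the `a`-th moment statistic. -/
def polarLag : Fin 3 → Fin 3 → ℕ := ![![1, 1, 1], ![2, 1, 1], ![4, 2, 2]]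

/-- Offset of the `t`-th quadratic variation in the `a`-th moment statistic. -/
def polarShift : Fin 3 → Fin 3 → ℕ := ![![0, 0, 0], ![0, 0, 1], ![0, 0, 2]]

lemma momentStat_eq_sum_avgSq {Ω : Type*} (Y : ℝ≥0 → Ω → ℝ) (h : ℝ≥0) (n : ℕ) (a : Fin 3) (ω : Ω) :
    momentStat Y h n a ω = ∑ t, polarWeight a t *
      avgSq (polarLag a t) (polarShift a t) n (fun k ↦ Y ((k : ℝ≥0) * h) ω) := by
  have h2 : ∀ y : ℕ → ℝ, ∀ j : ℕ,
      ∑ t : Fin 3, ![1 / 2, -1 / 2, -1 / 2] t *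
        avgSq (![2 * j, j, j] t) (![0, 0, j] t) n y =
      (1 / n) * ∑ k ∈ Finset.range n, (y (k + j) - y k) * (y (k + 2 * j) - y (k + j)) := by
    intro y j
    simp only [avgSq, Fin.sum_univ_three, Matrix.cons_val_zero, Matrix.cons_val_one,
      Matrix.cons_val, add_zero, Finset.mul_sum, ← Finset.sum_add_distrib]
    refine Finset.sum_congr rfl fun k _ ↦ ?_
    rw [show k + j + j = k + 2 * j by ring]
    ring
  fin_cases a
  · simp [momentStat, xiStat, avgSq, polarWeight, polarLag, polarShift, Fin.sum_univ_three, incr]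
  · exact (h2 (fun k ↦ Y ((k : ℝ≥0) * h) ω) 1).symm
  · exact (h2 (fun k ↦ Y ((k : ℝ≥0) * h) ω) 2).symm

lemma driftEst_eq {Ω : Type*} (Y : ℝ≥0 → Ω → ℝ) (h : ℝ≥0) (n : ℕ) (ω : Ω) :
    driftEst Y h n ω = (Y ((n : ℝ≥0) * h) ω - Y ((0 : ℕ) * h) ω) / (n * h) := by
  unfold driftEst incr
  rw [Finset.sum_range_sub (fun k : ℕ ↦ Y ((k : ℝ≥0) * h) ω) n]
  ring

lemma logSolution_grid {Ω : Type*} (σ : ℝ) (φ : Ω → ℝ) (M : ℝ≥0 → Ω → ℝ) (h : ℝ≥0) (k : ℕ)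
    (ω : Ω) : logSolution σ φ M ((k : ℝ≥0) * h) ω =
      driftPath h (drift σ φ) (fun k ↦ M ((k : ℝ≥0) * h)) ω k := by
  simp [logSolution, solution, driftPath, drift]

/-- The drift enters the statistics `ξ`, `η`, `ζ`, `θ̂²` as `driftDirection h a * θ²`. -/
def driftDirection (h : ℝ) : Fin 4 → ℝ := ![h ^ 2, h ^ 2, 4 * h ^ 2, 1]

lemma sum_polarWeight_mul_lag_sq (h : ℝ) (a : Fin 3) :
    ∑ t, polarWeight a t * (polarLag a t * h) ^ 2 = driftDirection h a.castSucc := by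
  fin_cases a <;>
    simp [polarWeight, polarLag, driftDirection, Fin.sum_univ_three] <;> ring

/-- The contribution of the noise to the mean of the `a`-th statistic, in terms of its variogram. -/
noncomputable def noiseMean (V : ℤ → ℝ) (a : Fin 3) : ℝ :=
  ∑ t, polarWeight a t * V (polarLag a t)

lemma momentStat_eq_of_grid {Ω : Type*} {θ : Ω → ℝ} {Z : ℕ → Ω → ℝ} {Y : ℝ≥0 → Ω → ℝ} {h : ℝ≥0}
    (hY : ∀ (k : ℕ) ω, Y ((k : ℝ≥0) * h) ω = driftPath h θ Z ω k) (n : ℕ) (a : Fin 3) :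
    momentStat Y h n a = fun ω ↦ ∑ t, polarWeight a t *
      avgSq (polarLag a t) (polarShift a t) n (driftPath h θ Z ω) := by
  ext ω
  rw [momentStat_eq_sum_avgSq]
  simp only [hY]

lemma driftEst_eq_of_grid {Ω : Type*} {θ : Ω → ℝ} {Z : ℕ → Ω → ℝ} {Y : ℝ≥0 → Ω → ℝ} {h : ℝ≥0}
    (hY : ∀ (k : ℕ) ω, Y ((k : ℝ≥0) * h) ω = driftPath h θ Z ω k)
    (hh : 0 < h) {n : ℕ} (hn : 0 < n) (ω : Ω) :
    driftEst Y h n ω = θ ω + (Z n ω - Z 0 ω) / (n * h) := by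
  have hn' : (n : ℝ) ≠ 0 := by exact_mod_cast hn.ne'
  have hh' : (h : ℝ) ≠ 0 := by exact_mod_cast hh.ne'
  rw [driftEst_eq, hY, hY, driftPath, driftPath]
  field_simp
  simp
  ring

section Subject

variable {Ω : Type*} [MeasurableSpace Ω] {P : Measure Ω} {V : ℤ → ℝ} {θ : Ω → ℝ} {Z : ℕ → Ω → ℝ}
  {Y : ℝ≥0 → Ω → ℝ} {h : ℝ≥0}

lemma memLp_momentStat (hS : IsSubject P V θ Z)
    (hY : ∀ (k : ℕ) ω, Y ((k : ℝ≥0) * h) ω = driftPath h θ Z ω k) {n : ℕ} (hn : 0 < n)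
    (a : Fin 3) : MemLp (momentStat Y h n a) 2 P := by
  rw [momentStat_eq_of_grid hY]
  exact memLp_finsetSum _ fun t _ ↦ (hS.memLp_avgSq_driftPath hn _ _ _).const_mul _

lemma integral_momentStat (hS : IsSubject P V θ Z)
    (hY : ∀ (k : ℕ) ω, Y ((k : ℝ≥0) * h) ω = driftPath h θ Z ω k) {n : ℕ} (hn : 0 < n)
    (a : Fin 3) : ∫ ω, momentStat Y h n a ω ∂P =
      driftDirection h a.castSucc * ∫ ω, θ ω ^ 2 ∂P + noiseMean V a := by
  have := hS.noise.isProbabilityMeasure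
  rw [momentStat_eq_of_grid hY, integral_finsetSum _ fun t _ ↦
    ((hS.memLp_avgSq_driftPath hn _ _ _).integrable one_le_two).const_mul _]
  simp only [integral_const_mul, hS.integral_avgSq_driftPath hn, mul_add, Finset.sum_add_distrib,
    ← sum_polarWeight_mul_lag_sq, noiseMean, Finset.sum_mul, mul_assoc]

lemma condExp_momentStat (hS : IsSubject P V θ Z)
    (hY : ∀ (k : ℕ) ω, Y ((k : ℝ≥0) * h) ω = driftPath h θ Z ω k) {n : ℕ} (hn : 0 < n)
    (a : Fin 3) : P[momentStat Y h n a | MeasurableSpace.comap θ inferInstance] =ᵐ[P]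
      fun ω ↦ driftDirection h a.castSucc * θ ω ^ 2 + noiseMean V a := by
  have := hS.noise.isProbabilityMeasure
  have hfun : momentStat Y h n a = ∑ t, polarWeight a t •
      fun ω ↦ avgSq (polarLag a t) (polarShift a t) n (driftPath h θ Z ω) := by
    rw [momentStat_eq_of_grid hY]
    ext ω; simp
  have hsum := condExp_finsetSum (μ := P) (s := Finset.univ)
    (f := fun t ↦ polarWeight a t •
      fun ω ↦ avgSq (polarLag a t) (polarShift a t) n (driftPath h θ Z ω))
    (fun t _ ↦ ((hS.memLp_avgSq_driftPath hn _ _ _).integrable one_le_two).smul _)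
    (MeasurableSpace.comap θ inferInstance)
  have hterm : ∀ᵐ ω ∂P, ∀ t, (P[polarWeight a t •
      fun ω ↦ avgSq (polarLag a t) (polarShift a t) n (driftPath h θ Z ω) |
        MeasurableSpace.comap θ inferInstance]) ω =
      polarWeight a t * ((polarLag a t * h) ^ 2 * θ ω ^ 2 + V (polarLag a t)) := by
    refine ae_all_iff.2 fun t ↦ ?_
    filter_upwards [condExp_smul (μ := P) (polarWeight a t)
      (fun ω ↦ avgSq (polarLag a t) (polarShift a t) n (driftPath h θ Z ω))
      (MeasurableSpace.comap θ inferInstance),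
      hS.condExp_avgSq_driftPath hn (polarLag a t) (polarShift a t) h] with ω h1 h2
    rw [h1, Pi.smul_apply, h2, smul_eq_mul]
  rw [hfun]
  filter_upwards [hsum, hterm] with ω h1 h2
  rw [h1, Finset.sum_apply]
  simp only [h2, mul_add, Finset.sum_add_distrib, ← sum_polarWeight_mul_lag_sq, noiseMean,
    Finset.sum_mul, mul_assoc]

lemma covariance_momentStat_sq (hS : IsSubject P V θ Z)
    (hY : ∀ (k : ℕ) ω, Y ((k : ℝ≥0) * h) ω = driftPath h θ Z ω k) {n : ℕ} (hn : 0 < n)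
    (a : Fin 3) : cov[momentStat Y h n a, fun ω ↦ θ ω ^ 2; P] =
      driftDirection h a.castSucc * Var[fun ω ↦ θ ω ^ 2; P] := by
  have := hS.noise.isProbabilityMeasure
  rw [momentStat_eq_of_grid hY, covariance_fun_sum_left
    (fun t ↦ (hS.memLp_avgSq_driftPath hn _ _ _).const_mul _) hS.memLp_drift_sq]
  simp only [covariance_const_mul_left, hS.covariance_avgSq_driftPath hn,
    ← sum_polarWeight_mul_lag_sq, Finset.sum_mul, mul_assoc]

lemma covariance_condExp_momentStat (hS : IsSubject P V θ Z)
    (hY : ∀ (k : ℕ) ω, Y ((k : ℝ≥0) * h) ω = driftPath h θ Z ω k) {n : ℕ} (hn : 0 < n)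
    (a b : Fin 3) : cov[P[momentStat Y h n a | MeasurableSpace.comap θ inferInstance],
        P[momentStat Y h n b | MeasurableSpace.comap θ inferInstance]; P] =
      driftDirection h a.castSucc * driftDirection h b.castSucc * Var[fun ω ↦ θ ω ^ 2; P] := by
  have := hS.noise.isProbabilityMeasure
  have ha := condExp_momentStat hS hY hn a
  have hb := condExp_momentStat hS hY hn b
  have hcongr : cov[P[momentStat Y h n a | MeasurableSpace.comap θ inferInstance],
        P[momentStat Y h n b | MeasurableSpace.comap θ inferInstance]; P] =
      cov[fun ω ↦ driftDirection h a.castSucc * θ ω ^ 2 + noiseMean V a,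
        fun ω ↦ driftDirection h b.castSucc * θ ω ^ 2 + noiseMean V b; P] := by
    unfold covariance
    rw [integral_congr_ae ha, integral_congr_ae hb]
    refine integral_congr_ae ?_
    filter_upwards [ha, hb] with ω h1 h2
    rw [h1, h2]
  rw [hcongr, covariance_add_const_left (hS.integrable_drift_sq.const_mul _),
    covariance_add_const_right (hS.integrable_drift_sq.const_mul _), covariance_const_mul_left,
    covariance_const_mul_right, covariance_self hS.memLp_drift_sq.aemeasurable]
  ring

lemma variance_driftEst_sq_tendsto (hS : IsSubject P V θ Z)
    (hY : ∀ (k : ℕ) ω, Y ((k : ℝ≥0) * h) ω = driftPath h θ Z ω k) (hh : 0 < h)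
    (hV : Tendsto (fun n : ℕ ↦ V n / (n * h : ℝ) ^ 2) atTop (𝓝 0)) :
    Tendsto (fun n ↦ Var[fun ω ↦ driftEst Y h n ω ^ 2; P]) atTop
      (𝓝 (Var[fun ω ↦ θ ω ^ 2; P])) := by
  rw [← tendsto_sub_nhds_zero_iff]
  have hlim : Tendsto (fun n : ℕ ↦ 8 * (∫ ω, θ ω ^ 2 ∂P) * (V n / (n * h : ℝ) ^ 2) +
      6 * (V n / (n * h : ℝ) ^ 2) ^ 2) atTop (𝓝 0) := by
    simpa using (hV.const_mul (8 * (∫ ω, θ ω ^ 2 ∂P))).add ((hV.pow 2).const_mul 6)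
  refine squeeze_zero_norm' ?_ hlim
  filter_upwards [eventually_gt_atTop 0] with n hn
  simp only [driftEst_eq_of_grid hY hh hn]
  exact hS.abs_variance_sq_drift_add_noise_sub_le n _

/-- The limit of the joint covariance matrix has rank one: all that survives is the variance of
`θ²`, spread along `driftDirection`. -/
lemma tendsto_jointCov (hS : IsSubject P V θ Z)
    (hY : ∀ (k : ℕ) ω, Y ((k : ℝ≥0) * h) ω = driftPath h θ Z ω k) (hh : 0 < h)
    (hV : Tendsto (fun n : ℕ ↦ V n / (n * h : ℝ) ^ 2) atTop (𝓝 0)) :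
    Tendsto (fun n ↦ jointCov P Y θ h n) atTop (𝓝 (Var[fun ω ↦ θ ω ^ 2; P] •
      Matrix.vecMulVec (driftDirection h) (driftDirection h))) := by
  refine tendsto_pi_nhds.2 fun a ↦ tendsto_pi_nhds.2 fun b ↦ ?_
  have hinl : ∀ a : Fin 3, finSumFinEquiv (m := 3) (n := 1) (Sum.inl a) = a.castSucc := fun a ↦ rfl
  have hinr : ∀ a : Fin 1, finSumFinEquiv (m := 3) (n := 1) (Sum.inr a) = 3 := by decide
  have h3 : driftDirection h 3 = 1 := rfl
  obtain ⟨a, rfl⟩ := (finSumFinEquiv (m := 3) (n := 1)).surjective a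
  obtain ⟨b, rfl⟩ := (finSumFinEquiv (m := 3) (n := 1)).surjective b
  simp only [jointCov, Matrix.reindex_apply, Matrix.submatrix_apply, Equiv.symm_apply_apply,
    Matrix.smul_apply, Matrix.vecMulVec_apply, smul_eq_mul]
  rcases a with a | a <;> rcases b with b | b
  · refine tendsto_const_nhds.congr' ?_
    filter_upwards [eventually_gt_atTop 0] with n hn
    rw [Matrix.fromBlocks_apply₁₁, condCov, Matrix.of_apply,
      covariance_condExp_momentStat hS hY hn, hinl, hinl]
    ring
  · refine tendsto_const_nhds.congr' ?_
    filter_upwards [eventually_gt_atTop 0] with n hn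
    rw [Matrix.fromBlocks_apply₁₂, crossCov, Matrix.of_apply,
      covariance_momentStat_sq hS hY hn, hinl, hinr, h3]
    ring
  · refine tendsto_const_nhds.congr' ?_
    filter_upwards [eventually_gt_atTop 0] with n hn
    rw [Matrix.fromBlocks_apply₂₁, crossCov, Matrix.transpose_apply, Matrix.of_apply,
      covariance_momentStat_sq hS hY hn, hinl, hinr, h3]
    ring
  · simp only [Matrix.fromBlocks_apply₂₂, Matrix.of_apply, hinr, h3, mul_one]
    exact variance_driftEst_sq_tendsto hS hY hh hV

end Subject

/-! ### The averaged statistics -/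

section Family

variable {Ω : Type*} [MeasurableSpace Ω] {P : Measure Ω} {V : ℤ → ℝ} {θ : ℕ → Ω → ℝ}
  {Z : ℕ → ℕ → Ω → ℝ} {Y : ℕ → ℝ≥0 → Ω → ℝ} {h : ℝ≥0} {n N : ℕ → ℕ}

lemma avgStat_castSucc {Ω : Type*} (Y : ℕ → ℝ≥0 → Ω → ℝ) (h : ℝ≥0) (n N : ℕ) (ω : Ω) (a : Fin 3) :
    avgStat Y h n N ω a.castSucc = (1 / N) * ∑ i ∈ Finset.range N, momentStat (Y i) h n a ω := by
  fin_cases a <;> rfl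

lemma avgStat_last {Ω : Type*} (Y : ℕ → ℝ≥0 → Ω → ℝ) (h : ℝ≥0) (n N : ℕ) (ω : Ω) :
    avgStat Y h n N ω 3 = (1 / N) * ∑ i ∈ Finset.range N, driftEst (Y i) h n ω ^ 2 := rfl

/-- The limit of the means of the averaged statistics. -/
noncomputable def limitMean (V : ℤ → ℝ) (m₂ h : ℝ) : Fin 4 → ℝ :=
  Fin.snoc (noiseMean V) 0 + m₂ • driftDirection h

lemma tendsto_integral_avgStat (hS : ∀ i, IsSubject P V (θ i) (Z i))
    (hY : ∀ i (k : ℕ) ω, Y i ((k : ℝ≥0) * h) ω = driftPath h (θ i) (Z i) ω k) (hh : 0 < h)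
    {m₂ : ℝ} (hm₂ : ∀ i, ∫ ω, θ i ω ^ 2 ∂P = m₂) (hN : Tendsto N atTop atTop)
    (hn : Tendsto n atTop atTop) (hV : Tendsto (fun n : ℕ ↦ V n / (n * h : ℝ) ^ 2) atTop (𝓝 0)) :
    Tendsto (fun m a ↦ ∫ ω, avgStat Y h (n m) (N m) ω a ∂P) atTop (𝓝 (limitMean V m₂ h)) := by
  have := (hS 0).noise.isProbabilityMeasure
  refine tendsto_pi_nhds.2 fun a ↦ ?_
  induction a using Fin.lastCases with
  | cast a =>
    refine tendsto_const_nhds.congr' ?_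
    filter_upwards [hN.eventually_gt_atTop 0, hn.eventually_gt_atTop 0] with m hNm hnm
    have hN' : (N m : ℝ) ≠ 0 := by exact_mod_cast hNm.ne'
    simp only [avgStat_castSucc]
    rw [integral_const_mul, integral_finsetSum _ fun i _ ↦
      (memLp_momentStat (hS i) (hY i) hnm a).integrable one_le_two]
    simp only [integral_momentStat (hS _) (hY _) hnm, hm₂, Finset.sum_const, Finset.card_range,
      nsmul_eq_mul, limitMean, Pi.add_apply, Pi.smul_apply, Fin.snoc_castSucc, smul_eq_mul]
    field_simp
    ring
  | last =>
    have hlim : Tendsto (fun m ↦ m₂ + V (n m) / ((n m : ℕ) * h : ℝ) ^ 2) atTop (𝓝 m₂) := by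
      simpa using (hV.comp hn).const_add m₂
    have e : limitMean V m₂ h (Fin.last 3) = m₂ := by
      have : driftDirection h (Fin.last 3) = 1 := rfl
      rw [limitMean, Pi.add_apply, Fin.snoc_last, Pi.smul_apply, this, smul_eq_mul, mul_one,
        zero_add]
    rw [e]
    refine hlim.congr' ?_
    filter_upwards [hN.eventually_gt_atTop 0, hn.eventually_gt_atTop 0] with m hNm hnm
    have hN' : (N m : ℝ) ≠ 0 := by exact_mod_cast hNm.ne'
    change _ = ∫ ω, avgStat Y h (n m) (N m) ω 3 ∂P
    simp only [avgStat_last, driftEst_eq_of_grid (hY _) hh hnm]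
    rw [integral_const_mul, integral_finsetSum _ fun i _ ↦
      ((hS i).memLp_sq_drift_add_noise _ _).integrable one_le_two]
    simp only [(hS _).integral_sq_drift_add_noise, hm₂, Finset.sum_const, Finset.card_range,
      nsmul_eq_mul]
    field_simp

/-- The drift-corrected statistics converge faster than at the rate `N ^ (-1/2)`. -/
lemma tendstoL1Zero_avgStat (hS : ∀ i, IsSubject P V (θ i) (Z i))
    (hY : ∀ i (k : ℕ) ω, Y i ((k : ℝ≥0) * h) ω = driftPath h (θ i) (Z i) ω k) (hh : 0 < h)
    (hind : iIndepFun (fun i ω k ↦ Z i k ω) P) {m₂ : ℝ} (hm₂ : ∀ i, ∫ ω, θ i ω ^ 2 ∂P = m₂)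
    (hN : Tendsto N atTop atTop) (hnN : Tendsto (fun m ↦ (n m : ℝ) / (N m : ℝ)) atTop atTop)
    (hV : ∀ j, Tendsto (fun d : ℕ ↦ incrCov V j d) atTop (𝓝 0))
    (hV' : Tendsto (fun n : ℕ ↦ √(n : ℝ) * (V n / (n : ℝ) ^ 2)) atTop (𝓝 0)) (a : Fin 3) :
    TendstoL1Zero P fun m ω ↦ √(N m : ℝ) * (avgStat Y h (n m) (N m) ω a.castSucc -
      driftDirection h a.castSucc * avgStat Y h (n m) (N m) ω 3 - noiseMean V a) := by
  have hn := tendsto_atTop_of_tendsto_div hN hnN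
  have hh' : (h : ℝ) ≠ 0 := by exact_mod_cast hh.ne'
  have key := TendstoL1Zero.finset_sum Finset.univ fun (t : Fin 3) _ ↦
    (tendstoL1Zero_residual hS hind hm₂ hN hnN hh' (polarLag a t) (polarShift a t) (hV _)
      hV').const_mul (polarWeight a t)
  refine key.congr' ?_
  filter_upwards [hN.eventually_gt_atTop 0, hn.eventually_gt_atTop 0] with m hNm hnm
  have hN' : (N m : ℝ) ≠ 0 := by exact_mod_cast hNm.ne'
  ext ω
  simp only [avgStat_castSucc, avgStat_last, momentStat_eq_of_grid (hY _),
    driftEst_eq_of_grid (hY _) hh hnm, ← sum_polarWeight_mul_lag_sq, noiseMean, scaledMean,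
    Fin.sum_univ_three, Finset.sum_sub_distrib, Finset.sum_add_distrib, ← Finset.mul_sum,
    Finset.sum_const, Finset.card_range, nsmul_eq_mul]
  generalize ∑ i ∈ Finset.range (N m),
    (θ i ω + (Z i (n m) ω - Z i 0 ω) / (n m * h)) ^ 2 = T
  field_simp
  ring

end Family

end MomentStatistics

/-! ### The estimator as a function of the statistics -/

section Estimator

section EstMap

lemma hurstMap_add_smul (h : ℝ) (x : Fin 4 → ℝ) (t : ℝ) :
    hurstMap h (x + t • driftDirection h) = hurstMap h x := by
  simp only [hurstMap, driftDirection, Pi.add_apply, Pi.smul_apply, smul_eq_mul, Matrix.cons_val]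
  ring_nf

lemma gammaSqMap_add_smul (h : ℝ) (x : Fin 4 → ℝ) (t : ℝ) :
    gammaSqMap h (x + t • driftDirection h) = gammaSqMap h x := by
  simp only [gammaSqMap, hurstMap_add_smul]
  simp only [driftDirection, Pi.add_apply, Pi.smul_apply, smul_eq_mul, Matrix.cons_val]
  ring_nf

lemma sigmaSqMap_add_smul (h : ℝ) (x : Fin 4 → ℝ) (t : ℝ) :
    sigmaSqMap h (x + t • driftDirection h) = sigmaSqMap h x := by
  simp only [sigmaSqMap, hurstMap_add_smul, gammaSqMap_add_smul]
  simp only [driftDirection, Pi.add_apply, Pi.smul_apply, smul_eq_mul, Matrix.cons_val]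
  ring_nf

/-- The estimator only sees the drift-corrected statistics, so it is constant along
`driftDirection`. -/
lemma estMap_add_smul (h : ℝ) (x : Fin 4 → ℝ) (t : ℝ) :
    estMap h (x + t • driftDirection h) = estMap h x := by
  simp only [estMap, hurstMap_add_smul, gammaSqMap_add_smul, sigmaSqMap_add_smul]

lemma measurable_hurstMap (h : ℝ) : Measurable (hurstMap h) := by
  have hlog : Measurable logTwoPlus := by
    unfold logTwoPlus Real.logb
    exact Measurable.ite measurableSet_Ioi (by fun_prop) measurable_const
  unfold hurstMap
  exact (hlog.comp (by fun_prop)).const_mul _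

lemma measurable_gammaSqMap (h : ℝ) : Measurable (gammaSqMap h) := by
  have := measurable_hurstMap h
  unfold gammaSqMap
  fun_prop

lemma measurable_estMap (h : ℝ) : Measurable (estMap h) := by
  have h1 := measurable_hurstMap h
  have h2 := measurable_gammaSqMap h
  refine measurable_pi_lambda _ fun a ↦ ?_
  fin_cases a
  · exact h1
  · exact h2
  · change Measurable (sigmaSqMap h)
    unfold sigmaSqMap
    fun_prop

/-- The noise means of the mixed process with parameters `(H, γ², σ²)`. -/
lemma noiseMean_mixedVariogram (σ γ H h : ℝ) :
    noiseMean (mixedVariogram (σ ^ 2 * h) (γ ^ 2 * h ^ (2 * H)) (2 * H)) =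
      ![σ ^ 2 * h + γ ^ 2 * h ^ (2 * H), γ ^ 2 * h ^ (2 * H) * (2 ^ (2 * H - 1) - 1),
        2 ^ (2 * H) * (γ ^ 2 * h ^ (2 * H) * (2 ^ (2 * H - 1) - 1))] := by
  have h4 : (4 : ℝ) ^ (2 * H) = 2 ^ (2 * H) * 2 ^ (2 * H) := by
    rw [← Real.mul_rpow (by norm_num) (by norm_num)]; norm_num
  have h2 : (2 : ℝ) ^ (2 * H - 1) = 2 ^ (2 * H) / 2 := by
    rw [Real.rpow_sub_one (by norm_num)]
  ext a
  fin_cases a <;>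
    simp [noiseMean, mixedVariogram, polarWeight, polarLag, Fin.sum_univ_three, h4, h2] <;> ring

variable {σ γ H h : ℝ} {x : Fin 4 → ℝ}

lemma hurstMap_eq (hγ : 0 < γ) (hH : 1 / 2 < H) (hh : 0 < h)
    (h1 : x 1 - h ^ 2 * x 3 = γ ^ 2 * h ^ (2 * H) * (2 ^ (2 * H - 1) - 1))
    (h2 : x 2 - 4 * h ^ 2 * x 3 = 2 ^ (2 * H) * (γ ^ 2 * h ^ (2 * H) * (2 ^ (2 * H - 1) - 1))) :
    hurstMap h x = H := by
  have hpos : (0 : ℝ) < 2 ^ (2 * H - 1) - 1 :=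
    sub_pos.2 (Real.one_lt_rpow one_lt_two (by linarith))
  have hne : γ ^ 2 * h ^ (2 * H) * (2 ^ (2 * H - 1) - 1) ≠ 0 := by positivity
  rw [hurstMap, h1, h2, mul_div_cancel_right₀ _ hne, logTwoPlus, if_pos (by positivity),
    Real.logb_rpow (by norm_num) (by norm_num)]
  ring

lemma estMap_eq (hγ : 0 < γ) (hH : 1 / 2 < H) (hh : 0 < h)
    (h0 : x 0 - h ^ 2 * x 3 = σ ^ 2 * h + γ ^ 2 * h ^ (2 * H))
    (h1 : x 1 - h ^ 2 * x 3 = γ ^ 2 * h ^ (2 * H) * (2 ^ (2 * H - 1) - 1))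
    (h2 : x 2 - 4 * h ^ 2 * x 3 = 2 ^ (2 * H) * (γ ^ 2 * h ^ (2 * H) * (2 ^ (2 * H - 1) - 1))) :
    estMap h x = ![H, γ ^ 2, σ ^ 2] := by
  have hpos : (0 : ℝ) < 2 ^ (2 * H - 1) - 1 :=
    sub_pos.2 (Real.one_lt_rpow one_lt_two (by linarith))
  have hhp : 0 < h ^ (2 * H) := by positivity
  have eH := hurstMap_eq hγ hH hh h1 h2
  have eγ : gammaSqMap h x = γ ^ 2 := by
    rw [gammaSqMap, eH, h1]
    field_simp
  have eσ : sigmaSqMap h x = σ ^ 2 := by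
    rw [sigmaSqMap, eγ, eH, h0]
    field_simp
    ring
  rw [estMap, eH, eγ, eσ]

lemma contDiffAt_estMap (hγ : 0 < γ) (hH : 1 / 2 < H) (hh : 0 < h)
    (h1 : x 1 - h ^ 2 * x 3 = γ ^ 2 * h ^ (2 * H) * (2 ^ (2 * H - 1) - 1))
    (h2 : x 2 - 4 * h ^ 2 * x 3 = 2 ^ (2 * H) * (γ ^ 2 * h ^ (2 * H) * (2 ^ (2 * H - 1) - 1))) :
    ContDiffAt ℝ 1 (estMap h) x := by
  have hpos : (0 : ℝ) < 2 ^ (2 * H - 1) - 1 :=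
    sub_pos.2 (Real.one_lt_rpow one_lt_two (by linarith))
  have hne : γ ^ 2 * h ^ (2 * H) * (2 ^ (2 * H - 1) - 1) ≠ 0 := by positivity
  have eH := hurstMap_eq hγ hH hh h1 h2
  have hden : x 1 - h ^ 2 * x 3 ≠ 0 := by rw [h1]; exact hne
  have hratio : 0 < (x 2 - 4 * h ^ 2 * x 3) / (x 1 - h ^ 2 * x 3) := by
    rw [h1, h2, mul_div_cancel_right₀ _ hne]; positivity
  have c : ∀ b : Fin 4, ContDiffAt ℝ 1 (fun x : Fin 4 → ℝ ↦ x b) x := fun b ↦ by fun_prop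
  have cden : ContDiffAt ℝ 1 (fun x : Fin 4 → ℝ ↦ x 1 - h ^ 2 * x 3) x := by fun_prop
  have cnum : ContDiffAt ℝ 1 (fun x : Fin 4 → ℝ ↦ x 2 - 4 * h ^ 2 * x 3) x := by fun_prop
  have cratio := cnum.div cden hden
  -- Near `x` the argument of the logarithm stays positive, so `log₂⁺` is the smooth `log₂`.
  have cH : ContDiffAt ℝ 1 (hurstMap h) x := by
    have : ContDiffAt ℝ 1 (fun x : Fin 4 → ℝ ↦ 1 / 2 *
        (Real.log ((x 2 - 4 * h ^ 2 * x 3) / (x 1 - h ^ 2 * x 3)) / Real.log 2)) x :=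
      contDiffAt_const.mul ((cratio.log hratio.ne').div_const _)
    refine this.congr_of_eventuallyEq ?_
    filter_upwards [cratio.continuousAt.eventually (lt_mem_nhds hratio)] with y hy
    rw [Pi.div_apply] at hy
    rw [hurstMap, logTwoPlus, if_pos hy, Real.logb]
  have c2H : ContDiffAt ℝ 1 (fun x ↦ 2 * hurstMap h x) x := contDiffAt_const.mul cH
  have cpow : ContDiffAt ℝ 1 (fun x ↦ h ^ (2 * hurstMap h x)) x :=
    contDiffAt_const.rpow c2H hh.ne'
  have cpow2 : ContDiffAt ℝ 1 (fun x ↦ (2 : ℝ) ^ (2 * hurstMap h x - 1) - 1) x :=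
    (contDiffAt_const.rpow (c2H.sub contDiffAt_const) two_ne_zero).sub contDiffAt_const
  have cγ : ContDiffAt ℝ 1 (gammaSqMap h) x := by
    refine cden.div (cpow.mul cpow2) ?_
    rw [eH]
    positivity
  have cσ : ContDiffAt ℝ 1 (sigmaSqMap h) x := by
    refine ContDiffAt.div_const (ContDiffAt.sub (ContDiffAt.sub (c 0) ?_) (cγ.mul cpow)) h
    exact contDiffAt_const.mul (c 3)
  refine contDiffAt_pi.2 fun a ↦ ?_
  fin_cases a
  · exact cH
  · exact cγ
  · exact cσ

/-- The Jacobian annihilates `driftDirection`, along which the estimator is constant. -/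
lemma jacobian_mulVec_driftDirection (hd : DifferentiableAt ℝ (estMap h) x) :
    (jacobian h x).mulVec (driftDirection h) = 0 := by
  have hline : HasDerivAt (fun t : ℝ ↦ estMap h (x + t • driftDirection h))
      (fderiv ℝ (estMap h) x (driftDirection h)) 0 := by
    have hd' : HasFDerivAt (estMap h) (fderiv ℝ (estMap h) x)
        (x + (0 : ℝ) • driftDirection h) := by simpa using hd.hasFDerivAt
    have hl : HasDerivAt (fun t : ℝ ↦ x + t • driftDirection h) (driftDirection h) 0 := by
      simpa using ((hasDerivAt_id (0 : ℝ)).smul_const (driftDirection h)).const_add x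
    exact hd'.comp_hasDerivAt (0 : ℝ) hl
  simp only [estMap_add_smul] at hline
  have hzero : fderiv ℝ (estMap h) x (driftDirection h) = 0 :=
    hline.unique (hasDerivAt_const _ _)
  ext a
  have hsum : driftDirection h = ∑ b, driftDirection h b • (Pi.single b 1 : Fin 4 → ℝ) := by
    ext c; simp [Finset.sum_apply, Pi.single_apply]
  have := congrFun hzero a
  rw [hsum, map_sum, Finset.sum_apply] at this
  simp only [map_smul, Pi.smul_apply, smul_eq_mul, Pi.zero_apply] at this
  simp only [Matrix.mulVec, dotProduct, jacobian, Matrix.of_apply, Pi.zero_apply]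
  rw [← this]
  exact Finset.sum_congr rfl fun b _ ↦ mul_comm _ _

lemma jacobian_mul_vecMulVec_mul_transpose (hd : DifferentiableAt ℝ (estMap h) x) (v : ℝ) :
    jacobian h x * (v • Matrix.vecMulVec (driftDirection h) (driftDirection h)) *
      (jacobian h x).transpose = 0 := by
  rw [Matrix.mul_smul, Matrix.mul_vecMulVec, jacobian_mulVec_driftDirection hd]
  simp

end EstMap

/-! ### Convergence of the estimator -/

lemma multivariateGaussian_zero_cov {ι : Type*} [Fintype ι] [DecidableEq ι]
    (μ : EuclideanSpace ℝ ι) : multivariateGaussian μ (0 : Matrix ι ι ℝ) = Measure.dirac μ := by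
  simp [multivariateGaussian]

lemma TendstoL1Zero.abs {Ω : Type*} [MeasurableSpace Ω] {P : Measure Ω} {F : ℕ → Ω → ℝ}
    (hF : TendstoL1Zero P F) : TendstoL1Zero P fun m ω ↦ |F m ω| :=
  ⟨hF.1.mono fun _ hm ↦ hm.abs, by simpa using hF.2⟩

lemma TendstoL1Zero.tendsto_measureReal {Ω : Type*} [MeasurableSpace Ω] {P : Measure Ω}
    {F : ℕ → Ω → ℝ} (hF : TendstoL1Zero P F) {ε : ℝ} (hε : 0 < ε) :
    Tendsto (fun m ↦ P.real {ω | ε ≤ |F m ω|}) atTop (𝓝 0) := by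
  refine squeeze_zero' (Eventually.of_forall fun m ↦ measureReal_nonneg) ?_
    (by simpa using hF.2.div_const ε)
  filter_upwards [hF.1] with m hm
  rw [le_div_iff₀' hε]
  exact mul_meas_ge_le_integral_of_nonneg (Eventually.of_forall fun ω ↦ abs_nonneg _) hm.abs ε

/-- Convergence at rate `o(N ^ (-1/2))` of statistics, corrected along a direction `u` in which `g`
is constant, is inherited by `g` of the statistics. -/
lemma tendstoInMeasure_sqrt_smul_sub {Ω : Type*} [MeasurableSpace Ω] {P : Measure Ω}
    [IsProbabilityMeasure P] {k : ℕ} {E : Type*} [NormedAddCommGroup E] [NormedSpace ℝ E]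
    {g : (Fin (k + 1) → ℝ) → E} {u : Fin (k + 1) → ℝ} (hu : u (Fin.last k) = 1)
    (hg : ∀ x (t : ℝ), g (x + t • u) = g x) {c : Fin k → ℝ}
    (hd : DifferentiableAt ℝ g (Fin.snoc c 0)) {N : ℕ → ℕ} (hN : Tendsto N atTop atTop)
    {T : ℕ → Ω → Fin (k + 1) → ℝ} (hT : ∀ a : Fin k, TendstoL1Zero P fun m ω ↦
      √(N m : ℝ) * (T m ω a.castSucc - u a.castSucc * T m ω (Fin.last k) - c a)) :
    TendstoInMeasure P (fun m ω ↦ √(N m : ℝ) • (g (T m ω) - g (Fin.snoc c 0))) atTop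
      (fun _ ↦ 0) := by
  obtain ⟨C, hC0, hC⟩ := hd.isBigO_sub.exists_pos
  obtain ⟨δ, hδ, hball⟩ := Metric.eventually_nhds_iff.1 hC.bound
  have hW := (TendstoL1Zero.finset_sum Finset.univ fun a _ ↦ (hT a).abs)
  rw [tendstoInMeasure_iff_measureReal_norm]
  intro ε hε
  have hη : 0 < min δ (ε / C) := lt_min hδ (by positivity)
  refine squeeze_zero' (Eventually.of_forall fun m ↦ measureReal_nonneg) ?_
    (hW.tendsto_measureReal hη)
  filter_upwards [hN.eventually_ge_atTop 1] with m hm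
  refine measureReal_mono fun ω hω ↦ ?_
  by_contra hcon
  simp only [Set.mem_ofPred_eq, not_le, sub_zero] at hcon hω
  set r : Fin k → ℝ := fun a ↦ T m ω a.castSucc - u a.castSucc * T m ω (Fin.last k) - c a with hr
  set W : ℝ := ∑ a, |√(N m : ℝ) * r a| with hWdef
  have hW0 : 0 ≤ W := Finset.sum_nonneg fun a _ ↦ abs_nonneg _
  rw [abs_of_nonneg hW0] at hcon
  have hdecomp : T m ω = (Fin.snoc c 0 + Fin.snoc r 0) + T m ω (Fin.last k) • u := by
    ext a
    induction a using Fin.lastCases with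
    | cast a =>
      simp only [hr, Pi.add_apply, Fin.snoc_castSucc, Pi.smul_apply, smul_eq_mul]
      ring
    | last => simp [hu]
  have hsqrt : 1 ≤ √(N m : ℝ) := Real.one_le_sqrt.2 (by exact_mod_cast hm)
  have hrW : √(N m : ℝ) * ‖(Fin.snoc r 0 : Fin (k + 1) → ℝ)‖ ≤ W := by
    have h0 : 0 ≤ W / √(N m : ℝ) := by positivity
    rw [mul_comm, ← le_div_iff₀ (by positivity), pi_norm_le_iff_of_nonneg h0]
    intro a
    induction a using Fin.lastCases with
    | cast a =>
      rw [Fin.snoc_castSucc, le_div_iff₀ (by positivity), Real.norm_eq_abs]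
      refine le_trans (le_of_eq ?_)
        (Finset.single_le_sum (f := fun a ↦ |√(N m : ℝ) * r a|) (fun a _ ↦ abs_nonneg _)
          (Finset.mem_univ a))
      rw [abs_mul, abs_of_nonneg (Real.sqrt_nonneg _), mul_comm]
    | last => simpa using h0
  have hrδ : ‖(Fin.snoc r 0 : Fin (k + 1) → ℝ)‖ < δ := by
    refine lt_of_le_of_lt ?_ (hcon.trans_le (min_le_left _ _))
    exact (le_mul_of_one_le_left (norm_nonneg _) hsqrt).trans hrW
  have hbound := hball (y := Fin.snoc c 0 + Fin.snoc r 0) (by simpa [dist_eq_norm] using hrδ)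
  rw [add_sub_cancel_left] at hbound
  rw [hdecomp, hg, norm_smul, Real.norm_of_nonneg (Real.sqrt_nonneg _)] at hω
  have : ε < ε := calc
    ε ≤ √(N m : ℝ) * (C * ‖(Fin.snoc r 0 : Fin (k + 1) → ℝ)‖) := hω.trans (by gcongr)
    _ = C * (√(N m : ℝ) * ‖(Fin.snoc r 0 : Fin (k + 1) → ℝ)‖) := by ring
    _ ≤ C * W := by gcongr
    _ < C * (ε / C) := by
      gcongr
      exact hcon.trans_le (min_le_right _ _)
    _ = ε := by field_simp
  exact lt_irrefl _ this

lemma measurable_avgStat {Ω : Type*} [MeasurableSpace Ω] {Y : ℕ → ℝ≥0 → Ω → ℝ}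
    (hY : ∀ i t, Measurable (Y i t)) (h : ℝ≥0) (n N : ℕ) : Measurable (avgStat Y h n N) := by
  refine measurable_pi_lambda _ fun a ↦ ?_
  fin_cases a <;>
    simp only [avgStat, xiStat, etaStat, zetaStat, driftEst, incr] <;>
    exact (Finset.measurable_sum _ fun i _ ↦ by fun_prop).const_mul _

end Estimator

end MixedFBS

theorem theorem1 {Ω : Type*} [MeasurableSpace Ω] (P : Measure Ω) [IsProbabilityMeasure P]
    (H σ γ : ℝ) (hH : H ∈ Set.Ioo (1 / 2 : ℝ) (3 / 4)) (hσ : 0 < σ) (hγ : 0 < γ)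
    (h : ℝ≥0) (hh : 0 < h)
    (B BH : ℕ → ℝ≥0 → Ω → ℝ) (φ : ℕ → Ω → ℝ) (hmodel : MixedFBS.Model P H σ γ B BH φ)
    (hA1 : ∀ i, Integrable (fun ω ↦ φ i ω ^ 4) P)
    (Y : ℕ → ℝ≥0 → Ω → ℝ)
    (hY : ∀ i, Y i = MixedFBS.logSolution σ (φ i) (MixedFBS.mixed σ γ (B i) (BH i)))
    (n N : ℕ → ℕ) (hN : Tendsto N atTop atTop)
    (hnN : Tendsto (fun m ↦ (n m : ℝ) / (N m : ℝ)) atTop atTop) :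
    ∃ (μ₀ : Fin 4 → ℝ) (S : Matrix (Fin 4) (Fin 4) ℝ),
      -- `μ₀` is the (limiting) mean of the averaged statistics
      Tendsto (fun m a ↦ ∫ ω, MixedFBS.avgStat Y h (n m) (N m) ω a ∂P) atTop (𝓝 μ₀) ∧
      -- `S` is the (limiting) joint covariance matrix of the statistics, the same for all subjects
      (∀ i, Tendsto
        (fun m ↦ MixedFBS.jointCov P (Y i) (MixedFBS.drift σ (φ i)) h (n m)) atTop (𝓝 S)) ∧
      S.PosSemidef ∧
      -- the Jacobian at `μ₀` is a genuine derivative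
      ContDiffAt ℝ 1 (MixedFBS.estMap h) μ₀ ∧
      -- `√N (Θ̂ - Θ)` converges in distribution to `N(0, J(μ₀) S J(μ₀)ᵀ)`
      TendstoInDistribution
        (fun m ω ↦ WithLp.toLp 2 fun a ↦
          √(N m : ℝ) * (MixedFBS.estimator Y h (n m) (N m) ω a - ![H, γ ^ 2, σ ^ 2] a))
        atTop (id : EuclideanSpace ℝ (Fin 3) → EuclideanSpace ℝ (Fin 3)) (fun _ ↦ P)
        (multivariateGaussian 0
          (MixedFBS.jacobian h μ₀ * S * (MixedFBS.jacobian h μ₀).transpose)) := by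
  open MixedFBS in
  obtain ⟨hH1, hH2⟩ := hH
  set V := mixedVariogram (σ ^ 2 * h) (γ ^ 2 * (h : ℝ) ^ (2 * H)) (2 * H) with hVdef
  set θ : ℕ → Ω → ℝ := fun i ↦ drift σ (φ i) with hθ
  set Z : ℕ → ℕ → Ω → ℝ := fun i k ↦ mixed σ γ (B i) (BH i) ((k : ℝ≥0) * h) with hZ
  have hh' : (0 : ℝ) < h := by exact_mod_cast hh
  have hS : ∀ i, IsSubject P V (θ i) (Z i) := fun i ↦
    hmodel.isSubject (by linarith) h (hA1 i)
  have hgrid : ∀ i (k : ℕ) ω, Y i ((k : ℝ≥0) * h) ω = driftPath h (θ i) (Z i) ω k := by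
    intro i k ω
    rw [hY i, logSolution_grid]
  have hm₂ : ∀ i, ∫ ω, θ i ω ^ 2 ∂P = ∫ ω, θ 0 ω ^ 2 ∂P := fun i ↦
    (hmodel.identDistrib_drift i 0).integral_eq
  have hvar : ∀ i, Var[fun ω ↦ θ i ω ^ 2; P] = Var[fun ω ↦ θ 0 ω ^ 2; P] := fun i ↦
    (hmodel.identDistrib_drift i 0).variance_eq
  have hn := tendsto_atTop_of_tendsto_div hN hnN
  have hV1 : ∀ j, Tendsto (fun d : ℕ ↦ incrCov V j d) atTop (𝓝 0) :=
    tendsto_mixedVariogram_second_difference (by linarith) (by linarith)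
  have hV2 : Tendsto (fun n : ℕ ↦ √(n : ℝ) * (V n / (n : ℝ) ^ 2)) atTop (𝓝 0) :=
    tendsto_sqrt_mul_mixedVariogram_div_sq (by linarith)
  have hV3 : Tendsto (fun n : ℕ ↦ V n / (n * h : ℝ) ^ 2) atTop (𝓝 0) := by
    refine squeeze_zero' (Eventually.of_forall fun n ↦
      div_nonneg ((hS 0).noise.variogram_nonneg n) (by positivity)) ?_
      (by simpa using hV2.div_const ((h : ℝ) ^ 2))
    filter_upwards [eventually_ge_atTop 1] with n hn1
    have h1 : 1 ≤ √(n : ℝ) := Real.one_le_sqrt.2 (by exact_mod_cast hn1)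
    rw [mul_pow, ← div_div]
    gcongr
    exact le_mul_of_one_le_left
      (div_nonneg ((hS 0).noise.variogram_nonneg n) (by positivity)) h1
  set c : Fin 4 → ℝ := Fin.snoc (noiseMean V) 0 with hc
  have hμ : limitMean V (∫ ω, θ 0 ω ^ 2 ∂P) h = c + (∫ ω, θ 0 ω ^ 2 ∂P) • driftDirection h := rfl
  have hcv := noiseMean_mixedVariogram σ γ H h
  have hca : ∀ a : Fin 3, c a.castSucc = noiseMean V a := fun a ↦ Fin.snoc_castSucc _ _ _
  have hc3 : c 3 = 0 := rfl
  have hμ0 : ∀ t : ℝ, (c + t • driftDirection h) 0 - h ^ 2 * (c + t • driftDirection h) 3 =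
      σ ^ 2 * h + γ ^ 2 * (h : ℝ) ^ (2 * H) := by
    intro t
    have := hca 0
    rw [hcv] at this
    simp only [Pi.add_apply, Pi.smul_apply, smul_eq_mul, hc3, driftDirection, Matrix.cons_val]
    simp at this
    rw [this]
    ring
  have hμ1 : ∀ t : ℝ, (c + t • driftDirection h) 1 - h ^ 2 * (c + t • driftDirection h) 3 =
      γ ^ 2 * (h : ℝ) ^ (2 * H) * (2 ^ (2 * H - 1) - 1) := by
    intro t
    have := hca 1
    rw [hcv] at this
    simp only [Pi.add_apply, Pi.smul_apply, smul_eq_mul, hc3, driftDirection, Matrix.cons_val]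
    simp at this
    rw [this]
    ring
  have hμ2 : ∀ t : ℝ, (c + t • driftDirection h) 2 - 4 * h ^ 2 * (c + t • driftDirection h) 3 =
      2 ^ (2 * H) * (γ ^ 2 * (h : ℝ) ^ (2 * H) * (2 ^ (2 * H - 1) - 1)) := by
    intro t
    have := hca 2
    rw [hcv] at this
    simp only [Pi.add_apply, Pi.smul_apply, smul_eq_mul, hc3, driftDirection, Matrix.cons_val]
    simp at this
    rw [this]
    ring
  have hcd : ∀ t : ℝ, ContDiffAt ℝ 1 (estMap h) (c + t • driftDirection h) := fun t ↦
    contDiffAt_estMap hγ hH1 hh' (hμ1 t) (hμ2 t)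
  have hc0 : c + (0 : ℝ) • driftDirection h = c := by simp
  have hest : estMap h c = ![H, γ ^ 2, σ ^ 2] :=
    hc0 ▸ estMap_eq hγ hH1 hh' (hμ0 0) (hμ1 0) (hμ2 0)
  refine ⟨limitMean V (∫ ω, θ 0 ω ^ 2 ∂P) h,
    Var[fun ω ↦ θ 0 ω ^ 2; P] • Matrix.vecMulVec (driftDirection h) (driftDirection h),
    tendsto_integral_avgStat hS hgrid hh hm₂ hN hn hV3, fun i ↦ ?_, ?_, hμ ▸ hcd _, ?_⟩
  · rw [← hvar i]
    exact (tendsto_jointCov (hS i) (hgrid i) hh hV3).comp hn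
  · have := Matrix.posSemidef_vecMulVec_self_star (driftDirection h)
    rw [star_trivial] at this
    exact this.smul (variance_nonneg _ _)
  have hmeas : ∀ m, Measurable fun ω ↦
      √(N m : ℝ) • (estMap h (avgStat Y h (n m) (N m) ω) - estMap h c) := by
    intro m
    have hYm : ∀ i t, Measurable (Y i t) := by
      intro i t
      have h1 := hmodel.measurable_B i t
      have h2 := hmodel.measurable_BH i t
      have h3 := hmodel.measurable_φ i
      rw [hY i]
      unfold logSolution solution mixed
      fun_prop
    have := (measurable_estMap h).comp (measurable_avgStat hYm h (n m) (N m))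
    exact (this.sub_const (estMap h c)).const_smul √(N m : ℝ)
  have hprob := tendstoInMeasure_sqrt_smul_sub (u := driftDirection h) rfl (estMap_add_smul h)
    ((hc0 ▸ hcd 0 : ContDiffAt ℝ 1 (estMap h) c).differentiableAt one_ne_zero) hN
    fun a ↦ tendstoL1Zero_avgStat hS hgrid hh (hmodel.iIndepFun_noise h) hm₂ hN hnN hV1 hV2 a
  have hdist := (hprob.tendstoInDistribution fun m ↦ (hmeas m).aemeasurable).continuous_comp
    (PiLp.continuous_toLp 2 fun _ : Fin 3 ↦ ℝ)
  -- `J` annihilates the direction of `S`, so the limit law is the Dirac mass at the origin.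
  have hJ := jacobian_mul_vecMulVec_mul_transpose
    ((hcd (∫ ω, θ 0 ω ^ 2 ∂P)).differentiableAt one_ne_zero) (Var[fun ω ↦ θ 0 ω ^ 2; P])
  have hfun : (fun m ω ↦ WithLp.toLp 2 fun a ↦
      √(N m : ℝ) * (estimator Y h (n m) (N m) ω a - ![H, γ ^ 2, σ ^ 2] a)) =
      fun m ↦ WithLp.toLp 2 ∘ fun ω ↦
        √(N m : ℝ) • (estMap h (avgStat Y h (n m) (N m) ω) - estMap h c) := by
    rw [hest]
    rfl
  have hlaw : (multivariateGaussian 0 (jacobian h (limitMean V (∫ ω, θ 0 ω ^ 2 ∂P) h) *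
      (Var[fun ω ↦ θ 0 ω ^ 2; P] • Matrix.vecMulVec (driftDirection h) (driftDirection h)) *
      (jacobian h (limitMean V (∫ ω, θ 0 ω ^ 2 ∂P) h)).transpose)).map id =
      P.map (WithLp.toLp 2 ∘ fun _ ↦ (0 : Fin 3 → ℝ)) := by
    rw [hμ, hJ, multivariateGaussian_zero_cov, Measure.map_id]
    exact (by simp [Measure.map_const] : P.map (fun _ ↦ (0 : EuclideanSpace ℝ (Fin 3))) = _).symm
  rw [hfun]
  refine ⟨hdist.forall_aemeasurable, aemeasurable_id, ?_⟩
  have := hdist.tendsto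
  convert this using 3
  exact congrArg 𝓝 (Subtype.ext hlaw)
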